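/- **Theorem (FedAvg with optimal client sampling, strongly convex case).** Let $f=\sum_{i=1}^n w_if_i$ on $\mathbb R^d$ with $w_i\ge 0$, $\sum_i w_i=1$, where every $f_i$ is $L$-smooth (differentiable with $L$-Lipschitz gradient, $L>0$) and $\mu$-strongly convex ($\mu>0$). Let $x^\star$ be the minimizer of $f$, $f^\star=f(x^\star)$, $f_i^\star=\inf f_i$, $Z_i=f_i(x^\star)-f_i^\star$, $W=\max_i w_i$. Fix integers $1\le m\le n$ and $R\ge 2$. *Algorithm.* In round $k$ each client $i$ puts $y_{i,0}^k=x^k$ and $y_{i,r+1}^k=y_{i,r}^k-\eta_l^k\,(\nabla f_i(y_{i,r}^k)+\xi_{i,r}^k)$ for $0\le r<R$, and forms $U_i^k=x^k-y_{i,R}^k$. The master puts $x^{k+1}=x^k-\eta_g^k\sum_{i\in S^k}\frac{w_i}{p_i^k}U_i^k$. The initial point $x^{0}$ is deterministic. *Noise.* The $\xi_{i,r}^k$ are square integrable; $\xi_{i,r}^k$ has conditional mean zero given all noise and samples of earlier rounds, the earlier noise of client $i$ in round $k$ and the noise of the other clients in round $k$ (as when clients are independent and each stochastic gradient is unbiased);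 and $\mathbb E[\|\xi_{i,r}^k\|^2\mid y_{i,r}^k]\le M\|\nabla f_i(y_{i,r}^k)\|^2+\sigma^2$ for some $M\ge 0$. *Optimal client sampling.* Given the past and the noise of round $k$, the set $S^k$ contains each $i$ independently with probability $p_i^k$. Here, with $u_i=\|w_iU_i^k\|$, ordered values $u_{(1)}\le\dots\le u_{(n)}$, and $l$ the largest integer $\le n$ with $m+l-n>0$ and $(m+l-n)\,u_{(l)}\le\sum_{j\le l}u_{(j)}$, we put $p_i^k=1$ if $l<n$ and $u_i\ge u_{(l+1)}$, and $p_i^k=(m+l-n)\,u_i/\sum_{j\le l}u_{(j)}$ otherwise ($0/0=0$). *Improvement factors.* Let $$\alpha^k=\frac{\mathbb E\|\sum_{i\in S^k}\frac{w_i}{p_i^k}U_i^k-\sum_i w_iU_i^k\|^2}{\mathbb E\|\sum_{i\in \mathcal U^k}\frac{n w_i}{m}U_i^k-\sum_i w_iU_i^k\|^2},\qquad \gamma^k=\frac{m}{\alpha^k(n-m)+m},$$ where $\mathcal U^k$ is an independent sampling, independent of everything else, with all inclusion probabilities $m/n$, and $\alpha^k=0$ if the denominator vanishes. *Conclusion.*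 Let $\eta^k=R\,\eta_l^k\eta_g^k$ and $r^k=x^k-x^\star$. If for some round $k$ $$\eta_g^k\ge\max\Big\{1,\sqrt{\tfrac{\gamma^k}{\sum_i w_i^2}}\Big\},\qquad 0<\eta^k\le\frac18\min\Big\{\frac{1}{L(2+M/R)},\ \frac{\gamma^k}{(1+W(1+M/R))L}\Big\},$$ then $f(x^k)-f^\star$, $\|r^k\|^2$ and $\|r^{k+1}\|^2$ are integrable and $$\frac38\,\mathbb E(f(x^k)-f^\star)\le\frac1{\eta^k}\Big(1-\frac{\mu\eta^k}2\Big)\mathbb E\|r^k\|^2-\frac1{\eta^k}\mathbb E\|r^{k+1}\|^2+\eta^k\beta_1^k+(\eta^k)^2\beta_2,$$ where $$\beta_1^k=\frac{2\sigma^2}{\gamma^kR}\sum_i w_i^2+\frac{4L}{\gamma^k}\Big(\frac MR+1-\gamma^k\Big)\sum_i w_i^2Z_i,\qquad \beta_2=72L^2\Big(1+\frac MR\Big)\sum_i w_iZ_i .$$ -/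

import Mathlib

open MeasureTheory

/-- The parameter space `ℝ^d` with its Euclidean norm. -/
abbrev Vec (d : ℕ) : Type := EuclideanSpace ℝ (Fin d)

/-- `h` is differentiable and its gradient is `L`-Lipschitz. -/
def LSmooth {d : ℕ} (L : ℝ) (h : Vec d → ℝ) : Prop :=
  Differentiable ℝ h ∧ ∀ x y, ‖gradient h x - gradient h y‖ ≤ L * ‖x - y‖

/-- First-order strong convexity with modulus `μ` of a differentiable function. -/
def GradStronglyConvex {d : ℕ} (μ : ℝ) (h : Vec d → ℝ) : Prop :=
  ∀ x y, h x + inner ℝ (gradient h x) (y - x) + μ / 2 * ‖y - x‖ ^ 2 ≤ h y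

noncomputable section

/-! ### Independent sampling and the optimal probabilities -/

/-- The probability that the independent sampling with inclusion probabilities `p` equals `A`. -/
def independentSamplingProb {n : ℕ} (p : Fin n → ℝ) (A : Finset (Fin n)) : ℝ :=
  (∏ i ∈ A, p i) * ∏ i ∈ Aᶜ, (1 - p i)

/-- `E ‖∑_{i ∈ S} v i / p i - ∑ i, v i‖²` over the independent sampling `S` with inclusion
probabilities `p`, the vectors `v i` being fixed. -/
def samplingVariance {n d : ℕ} (p : Fin n → ℝ) (v : Fin n → Vec d) : ℝ :=
  ∑ A : Finset (Fin n), independentSamplingProb p A *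
    ‖(∑ i ∈ A, (p i)⁻¹ • v i) - ∑ i, v i‖ ^ 2

/-- The `j`-th smallest of the values `u i`, for `1 ≤ j ≤ n` (and `0` for `j > n`). -/
def orderStat {n : ℕ} (u : Fin n → ℝ) (j : ℕ) : ℝ :=
  if h : j - 1 < n then u (Tuple.sort u ⟨j - 1, h⟩) else 0

/-- The sum of the `l` smallest of the values `u i`. -/
def lowerSum {n : ℕ} (u : Fin n → ℝ) (l : ℕ) : ℝ :=
  ∑ j ∈ Finset.Icc 1 l, orderStat u j

open Classical in
/-- The largest `l ≤ n` with `0 < m + l - n ≤ (u_(1) + ⋯ + u_(l)) / u_(l)`. The inequality is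
multiplied by `u_(l)`, which gives it a meaning when `u_(l) = 0`. -/
def ocsIndex {n : ℕ} (m : ℕ) (u : Fin n → ℝ) : ℕ :=
  Nat.findGreatest
    (fun l => n < m + l ∧ ((m : ℝ) + l - n) * orderStat u l ≤ lowerSum u l) n

open Classical in
/-- The optimal inclusion probabilities for the weighted update norms `u i` and the expected
number `m` of communicating clients. The set of clients with probability one by the first branch
is empty when `l = n`. -/
def ocsProb {n : ℕ} (m : ℕ) (u : Fin n → ℝ) (i : Fin n) : ℝ :=
  if ocsIndex m u < n ∧ orderStat u (ocsIndex m u + 1) ≤ u i then 1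
  else ((m : ℝ) + ocsIndex m u - n) * u i / lowerSum u (ocsIndex m u)

/-! ### The algorithm -/

/-- The input of `FedAvg` with `n` clients in dimension `d`. -/
structure FedAvg (n d : ℕ) where
  /-- local loss functions -/
  f : Fin n → Vec d → ℝ
  /-- client weights -/
  w : Fin n → ℝ
  /-- expected number of clients that communicate in a round -/
  m : ℕ
  /-- number of local steps in a round -/
  R : ℕ
  /-- local step sizes, one for each round -/
  ηl : ℕ → ℝ
  /-- global step sizes, one for each round -/
  ηg : ℕ → ℝ
  /-- initial global model -/
  x₀ : Vec d

namespace FedAvg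

variable {n d : ℕ} (A : FedAvg n d)

/-- The global objective `∑ i, w i * f i`. -/
def obj (x : Vec d) : ℝ := ∑ i, A.w i * A.f i x

/-- Local model of client `i` in round `k` after `r` local steps, when the round starts at `x` and
`ζ s` is the noise of the `s`-th stochastic gradient: `y₀ = x`,
`y_{r+1} = y_r - ηl (∇ f_i (y_r) + ζ_r)`. -/
def localModel (k : ℕ) (i : Fin n) (x : Vec d) (ζ : ℕ → Vec d) : ℕ → Vec d
  | 0 => x
  | r + 1 => localModel k i x ζ r - A.ηl k • (gradient (A.f i) (localModel k i x ζ r) + ζ r)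

/-- The update `U_i = x - y_{i,R}` of client `i`, for the noise `ζ` of the round. -/
def update (k : ℕ) (x : Vec d) (ζ : Fin n → ℕ → Vec d) (i : Fin n) : Vec d :=
  x - A.localModel k i x (ζ i) A.R

/-- The inclusion probabilities of optimal client sampling in a round. -/
def prob (k : ℕ) (x : Vec d) (ζ : Fin n → ℕ → Vec d) : Fin n → ℝ :=
  ocsProb A.m (fun i => ‖A.w i • A.update k x ζ i‖)

/-- The global models: `x_{k+1} = x_k - ηg ∑_{i ∈ S_k} (w_i / p_i) U_i`, for the noise `ξ` and
the sets `S` of communicating clients (rounds are numbered from `0`). -/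
def model (ξ : ℕ → Fin n → ℕ → Vec d) (S : ℕ → Finset (Fin n)) : ℕ → Vec d
  | 0 => A.x₀
  | k + 1 => model ξ S k - A.ηg k • ∑ i ∈ S k,
      (A.w i / A.prob k (model ξ S k) (ξ k) i) • A.update k (model ξ S k) (ξ k) i

section Random

variable {Ω : Type*} (ξ : ℕ → Fin n → ℕ → Ω → Vec d) (S : ℕ → Ω → Finset (Fin n))

/-- The random global model `x^k`. -/
def x (k : ℕ) (ω : Ω) : Vec d :=
  A.model (fun k i r => ξ k i r ω) (fun k => S k ω) k

/-- The random local model `y_{i,r}^k`. -/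
def y (k : ℕ) (i : Fin n) (r : ℕ) (ω : Ω) : Vec d :=
  A.localModel k i (A.x ξ S k ω) (fun s => ξ k i s ω) r

/-- The random update `U_i^k`. -/
def U (k : ℕ) (i : Fin n) (ω : Ω) : Vec d :=
  A.update k (A.x ξ S k ω) (fun j s => ξ k j s ω) i

/-- The random inclusion probability `p_i^k`. -/
def p (k : ℕ) (i : Fin n) (ω : Ω) : ℝ :=
  A.prob k (A.x ξ S k ω) (fun j s => ξ k j s ω) i

/-- The history before round `k`: all noise and all sampled sets of the previous rounds. -/
abbrev past (k : ℕ) : MeasurableSpace Ω :=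
  (⨆ (k' : ℕ) (_ : k' < k) (i : Fin n) (r : ℕ) (_ : r < A.R),
    MeasurableSpace.comap (ξ k' i r) inferInstance) ⊔
  ⨆ (k' : ℕ) (_ : k' < k), MeasurableSpace.comap (S k') ⊤

/-- What the noise `ξ_{i,r}^k` is conditioned on: the history before round `k`, the earlier noise
of client `i` in round `k`, and the noise of all other clients in round `k`. -/
abbrev noisePast (k : ℕ) (i : Fin n) (r : ℕ) : MeasurableSpace Ω :=
  A.past ξ S k ⊔
  ⨆ (j : Fin n) (s : ℕ) (_ : s < A.R) (_ : j ≠ i ∨ s < r),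
    MeasurableSpace.comap (ξ k j s) inferInstance

/-- What the sampling of round `k` is conditioned on: the history before round `k` and the whole
noise of round `k`. -/
abbrev samplingPast (k : ℕ) : MeasurableSpace Ω :=
  A.past ξ S k ⊔
  ⨆ (j : Fin n) (s : ℕ) (_ : s < A.R), MeasurableSpace.comap (ξ k j s) inferInstance

variable [MeasurableSpace Ω] (P : Measure Ω)

/-- The stochastic gradients `∇ f_i (y_{i,r}^k) + ξ_{i,r}^k` of the first `K` rounds are unbiased
given the past and the other clients, and
`E[‖ξ_{i,r}^k‖² | y_{i,r}^k] ≤ M ‖∇ f_i (y_{i,r}^k)‖² + σ²`. -/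
structure GradientOracle (K : ℕ) (M σ : ℝ) : Prop where
  measurable : ∀ k < K, ∀ i, ∀ r < A.R, Measurable (ξ k i r)
  memLp : ∀ k < K, ∀ i, ∀ r < A.R, MemLp (ξ k i r) 2 P
  unbiased : ∀ k < K, ∀ i, ∀ r < A.R, P[ξ k i r | A.noisePast ξ S k i r] =ᵐ[P] 0
  variance : ∀ k < K, ∀ i, ∀ r < A.R,
    P[fun ω => ‖ξ k i r ω‖ ^ 2 | MeasurableSpace.comap (A.y ξ S k i r) inferInstance]
      ≤ᵐ[P] fun ω => M * ‖gradient (A.f i) (A.y ξ S k i r ω)‖ ^ 2 + σ ^ 2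

/-- In each of the first `K` rounds, given the updates and the history, the set of communicating
clients is an independent sampling with the optimal inclusion probabilities. -/
structure OptimalClientSampling (K : ℕ) : Prop where
  measurable : ∀ k < K, ∀ B : Finset (Fin n), MeasurableSet {ω | S k ω = B}
  law : ∀ k < K, ∀ B : Finset (Fin n),
    P[Set.indicator {ω | S k ω = B} (fun _ => (1 : ℝ)) | A.samplingPast ξ S k]
      =ᵐ[P] fun ω => independentSamplingProb (fun i => A.p ξ S k i ω) B

/-- The improvement factor `α^k` of optimal over uniform sampling: the ratio of the expected
sampling variances (`0` if the denominator vanishes). -/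
def improvement (k : ℕ) : ℝ :=
  (∫ ω, samplingVariance (fun i => A.p ξ S k i ω) (fun i => A.w i • A.U ξ S k i ω) ∂P) /
  ∫ ω, samplingVariance (fun _ => (A.m : ℝ) / n) (fun i => A.w i • A.U ξ S k i ω) ∂P

/-- The relative improvement factor `γ^k = m / (α^k (n - m) + m)`. -/
def γ (k : ℕ) : ℝ :=
  A.m / (A.improvement ξ S P k * ((n : ℝ) - A.m) + A.m)

end Random

/-- The effective step size `η^k = R ηl^k ηg^k`. -/
def η (k : ℕ) : ℝ := A.R * A.ηl k * A.ηg k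

/-- The largest client weight `W`. -/
def W : ℝ := ⨆ i, A.w i

/-- The mismatch `Z_i = f_i(x⋆) - inf f_i`. -/
def Z (xstar : Vec d) (i : Fin n) : ℝ := A.f i xstar - ⨅ z, A.f i z

/-- The constant `β₁`, as a function of the value `g` of the relative improvement factor. -/
def β₁ (xstar : Vec d) (L M σ g : ℝ) : ℝ :=
  2 * σ ^ 2 / (g * A.R) * ∑ i, A.w i ^ 2 +
    4 * L / g * (M / A.R + 1 - g) * ∑ i, A.w i ^ 2 * A.Z xstar i

/-- The constant `β₂`. -/
def β₂ (xstar : Vec d) (L M : ℝ) : ℝ :=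
  72 * L ^ 2 * (1 + M / A.R) * ∑ i, A.w i * A.Z xstar i

end FedAvg

end

/-!
Write `g_i` for the average of the `R` stochastic gradients of client `i` in a round, so that
`U_i = R ηl g_i` and a round moves `x` by `-η ∑ i ∈ S, (w i / p i) g_i`.

*Sampling.* The optimal probabilities lie in `[0, 1]`, vanish only where the update vanishes, and
satisfy `u_i² / p_i ≤ u_i ∑ u_j` (`inv_ocsProb_mul_sq_le`). Integrating out the set `S` therefore
splits `E ‖x⁺ - x⋆‖²` into the step with all clients and the sampling variance
`∑ (1/p_i - 1) ‖w_i U_i‖²`, and the iterates stay square integrable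
(`FedAvg.Standing.memLp_x`). By the definition of `γ` the expected sampling variance is
`(1/γ - 1) ∑ w_i² E ‖U_i‖²`, whence the recursion
`E ‖x⁺ - x⋆‖² = E ‖r‖² - 2 η E ⟨r, ∑ w_i g_i⟩ + η² (E ‖∑ w_i g_i‖² + (1/γ - 1) ∑ w_i² E ‖g_i‖²)`
with `r = x - x⋆` (`FedAvg.Standing.integral_norm_x_succ_sub_sq_eq`).

*Inner product.* Strong convexity at the perturbed points `y_{i,r}` gives
`E ⟨r, ∑ w_i g_i⟩ ≥ E (f x - f⋆) + (μ/4) E ‖r‖² - L ∑ w_i V_i`, where `V_i` is the mean squared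
drift of the local models (`FedAvg.Standing.le_integral_inner_update`).

*Second moment.* The noise of a local step is orthogonal to the past and to the other clients, but
not to the later gradients of the same client. So `g_i` is split into the gradient at `x`, the
deviation of the averaged gradient from it, and the averaged noise. The noise is orthogonal to the
first part, and the deviation is at most `L² V_i` in mean square; this leads to
`E ‖g_i‖² ≤ 4/3 E ‖∇ f_i x‖² + 11 L² V_i + 8/7 E ‖noise‖²` and to the analogous bound for
`∑ w_i g_i`, in which the noises of different clients add up with the squared weights.

*Squared weights.* The differences `f_i x - f_i x⋆` may be negative, so that
`∑ w_i² (f_i x - f_i x⋆)` is not bounded by the suboptimality of `x`. The Bregman divergences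
`D_i` of the `f_i` from `x⋆` are nonnegative and satisfy `∑ w_i D_i = f x - f⋆`, because the
weighted gradients cancel at `x⋆`; together with `‖∇ f_i x‖² ≤ 6 L D_i + 3 L Z_i` they take over that role.

*Step sizes.* The numerical factors are chosen such that `4/3 * 3 L` is exactly the coefficient
`4 L` of `β₁`, while the `D_i` cost at most one unit of `E (f x - f⋆)` and the drift at most `5/8`,
out of the `2 - 3/8` that are available (`round_arithmetic`). The drift contributes `L η_l² R σ²` to
the noise; the lower bound on `η_g` turns `(R η_l)²` into `η² ∑ w_i² / γ`, as `β₁` demands.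
-/

open MeasureTheory

noncomputable section

/-! ### Smooth and strongly convex functions -/

section SmoothConvex

variable {d : ℕ} {L μ : ℝ} {h : Vec d → ℝ}

lemma LSmooth.hasGradientAt (hh : LSmooth L h) (x : Vec d) : HasGradientAt h (gradient h x) x :=
  (hh.1 x).hasGradientAt

lemma LSmooth.continuous_gradient (hh : LSmooth L h) : Continuous (gradient h) :=
  (LipschitzWith.of_dist_le_mul (K := L.toNNReal) fun x y => by
    rw [dist_eq_norm, dist_eq_norm]
    exact (hh.2 x y).trans (by gcongr; exact Real.le_coe_toNNReal L)).continuous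

/-- The descent lemma. -/
lemma LSmooth.le_quadratic (hh : LSmooth L h) (x y : Vec d) :
    h y ≤ h x + inner ℝ (gradient h x) (y - x) + L / 2 * ‖y - x‖ ^ 2 := by
  set v := y - x with hv
  let φ : ℝ → ℝ := fun t =>
    h (x + t • v) - t * inner ℝ (gradient h x) v - L / 2 * t ^ 2 * ‖v‖ ^ 2
  have hd : ∀ t, HasDerivAt φ
      (inner ℝ (gradient h (x + t • v)) v - inner ℝ (gradient h x) v - L * t * ‖v‖ ^ 2) t := by
    intro t
    have h1 : HasDerivAt (fun t : ℝ => x + t • v) v t := by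
      simpa using ((hasDerivAt_id t).smul_const v).const_add x
    have h2 := (hh.hasGradientAt (x + t • v)).hasFDerivAt.comp_hasDerivAt t h1
    have h3 := (hasDerivAt_id t).mul_const (inner ℝ (gradient h x) v)
    have h4 := ((hasDerivAt_pow 2 t).const_mul (L / 2)).mul_const (‖v‖ ^ 2)
    refine ((h2.sub h3).sub h4).congr_deriv ?_
    rw [InnerProductSpace.toDual_apply_apply]
    push_cast
    ring
  have hanti : AntitoneOn φ (Set.Icc 0 1) := by
    refine antitoneOn_of_deriv_nonpos (convex_Icc 0 1)
      (fun t _ => (hd t).continuousAt.continuousWithinAt)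
      (fun t _ => (hd t).differentiableAt.differentiableWithinAt) fun t ht => ?_
    rw [interior_Icc] at ht
    rw [(hd t).deriv, ← inner_sub_left]
    have h5 := hh.2 (x + t • v) x
    rw [add_sub_cancel_left, norm_smul, Real.norm_of_nonneg ht.1.le] at h5
    have h6 := real_inner_le_norm (gradient h (x + t • v) - gradient h x) v
    nlinarith [mul_le_mul_of_nonneg_right h5 (norm_nonneg v)]
  have h01 := hanti (Set.left_mem_Icc.2 zero_le_one) (Set.right_mem_Icc.2 zero_le_one) zero_le_one
  simp only [φ, one_smul, zero_smul, add_zero] at h01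
  rw [show x + v = y by rw [hv]; abel] at h01
  linarith

/-- The Bregman divergence `h x - h y - ⟨∇ h y, x - y⟩`. -/
def bregman (h : Vec d → ℝ) (x y : Vec d) : ℝ := h x - h y - inner ℝ (gradient h y) (x - y)

lemma GradStronglyConvex.bregman_nonneg (hc : GradStronglyConvex μ h) (hμ : 0 < μ) (x y : Vec d) :
    0 ≤ bregman h x y := by
  have := hc y x
  have : 0 ≤ μ / 2 * ‖x - y‖ ^ 2 := by positivity
  unfold bregman
  linarith

/-- A gradient step from `x` decreases `h` by at least `‖∇ h x‖² / (2 L)`. -/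
lemma LSmooth.norm_gradient_sq_le (hh : LSmooth L h) (hL : 0 < L) {c : ℝ} (hc : ∀ z, c ≤ h z)
    (x : Vec d) : ‖gradient h x‖ ^ 2 ≤ 2 * L * (h x - c) := by
  have h1 := hh.le_quadratic x (x - L⁻¹ • gradient h x)
  have h2 := hc (x - L⁻¹ • gradient h x)
  rw [sub_sub_cancel_left, inner_neg_right, inner_smul_right, norm_neg, norm_smul,
    real_inner_self_eq_norm_sq, Real.norm_of_nonneg (by positivity)] at h1
  have h3 : L / 2 * (L⁻¹ * ‖gradient h x‖) ^ 2 = L⁻¹ * ‖gradient h x‖ ^ 2 / 2 := by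
    field_simp
  have h4 : ‖gradient h x‖ ^ 2 = 2 * L * (L⁻¹ * ‖gradient h x‖ ^ 2 / 2) := by
    field_simp
  rw [h4]
  gcongr
  linarith

/-- The gradient of a smooth convex function is controlled by its Bregman divergence: compare the
linear lower bound at `y` and the quadratic upper bound at `x` in the point
`x - (∇ h x - ∇ h y) / L`. -/
lemma LSmooth.norm_gradient_sub_sq_le (hh : LSmooth L h) (hL : 0 < L)
    (hc : GradStronglyConvex μ h) (hμ : 0 < μ) (x y : Vec d) :
    ‖gradient h x - gradient h y‖ ^ 2 ≤ 2 * L * bregman h x y := by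
  set g := gradient h x - gradient h y with hg
  have h1 := hh.le_quadratic x (x - L⁻¹ • g)
  have h2 := hc.bregman_nonneg hμ (x - L⁻¹ • g) y
  unfold bregman at h2 ⊢
  rw [sub_sub_cancel_left, inner_neg_right, inner_smul_right, norm_neg, norm_smul,
    Real.norm_of_nonneg (by positivity)] at h1
  rw [sub_right_comm x, inner_sub_right, inner_smul_right] at h2
  have h5 : inner ℝ (gradient h x) g - inner ℝ (gradient h y) g = ‖g‖ ^ 2 := by
    rw [← inner_sub_left, ← hg, real_inner_self_eq_norm_sq]
  have h3 : L / 2 * (L⁻¹ * ‖g‖) ^ 2 = L⁻¹ * ‖g‖ ^ 2 / 2 := by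
    field_simp
  have h4 : ‖g‖ ^ 2 = 2 * L * (L⁻¹ * ‖g‖ ^ 2 / 2) := by
    field_simp
  rw [h4]
  gcongr
  have h6 : L⁻¹ * ‖g‖ ^ 2 = L⁻¹ * inner ℝ (gradient h x) g - L⁻¹ * inner ℝ (gradient h y) g := by
    rw [← h5]; ring
  linarith

lemma GradStronglyConvex.bddBelow (hc : GradStronglyConvex μ h) (hμ : 0 < μ) :
    BddBelow (Set.range h) := by
  refine ⟨h 0 - ‖gradient h 0‖ ^ 2 / (2 * μ), ?_⟩
  rintro _ ⟨z, rfl⟩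
  have h1 := hc 0 z
  rw [sub_zero] at h1
  have h2 := neg_le_of_abs_le (abs_real_inner_le_norm (gradient h 0) z)
  have h3 : 0 ≤ (‖gradient h 0‖ - μ * ‖z‖) ^ 2 / (2 * μ) := by positivity
  have h4 : (‖gradient h 0‖ - μ * ‖z‖) ^ 2 / (2 * μ) =
      ‖gradient h 0‖ ^ 2 / (2 * μ) - ‖gradient h 0‖ * ‖z‖ + μ / 2 * ‖z‖ ^ 2 := by
    field_simp
    ring
  linarith

/-- The gradient at `x` is controlled by the Bregman divergence to `y` and the suboptimality
of `y`. -/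
lemma LSmooth.norm_gradient_sq_le_bregman (hh : LSmooth L h) (hL : 0 < L)
    (hc : GradStronglyConvex μ h) (hμ : 0 < μ) (x y : Vec d) :
    ‖gradient h x‖ ^ 2 ≤ 6 * L * bregman h x y + 3 * L * (h y - ⨅ z, h z) := by
  have h1 := hh.norm_gradient_sub_sq_le hL hc hμ x y
  have h2 := hh.norm_gradient_sq_le hL (fun z => ciInf_le (hc.bddBelow hμ) z) y
  have h3 : ‖gradient h x‖ ≤ ‖gradient h x - gradient h y‖ + ‖gradient h y‖ := by
    simpa using norm_add_le (gradient h x - gradient h y) (gradient h y)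
  have h4 := pow_le_pow_left₀ (norm_nonneg _) h3 2
  -- `(a + b)² ≤ 3 a² + 3 / 2 b²`
  nlinarith [sq_nonneg (2 * ‖gradient h x - gradient h y‖ - ‖gradient h y‖)]

/-- Strong convexity along `x - z` when the gradient is evaluated at a perturbation `y` of `x`. -/
lemma LSmooth.le_inner_perturbed (hh : LSmooth L h)
    (hc : GradStronglyConvex μ h) (hμ : 0 < μ) (x y z : Vec d) :
    h x - h z + μ / 4 * ‖x - z‖ ^ 2 - L * ‖y - x‖ ^ 2 ≤ inner ℝ (gradient h y) (x - z) := by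
  have h1 := hc y z
  have h2 := hh.le_quadratic y x
  -- `h3` and `h4` yield `μ ‖y - x‖² ≤ L ‖y - x‖²`, which avoids `μ ≤ L` (it may fail for `d = 0`).
  have h3 := hc x y
  have h4 := hh.le_quadratic x y
  have h5 : inner ℝ (gradient h y) (x - z) =
      inner ℝ (gradient h y) (x - y) - inner ℝ (gradient h y) (z - y) := by
    rw [← inner_sub_right]
    congr 1
    abel
  have h6 : ‖x - z‖ ≤ ‖y - x‖ + ‖z - y‖ := by
    rw [norm_sub_rev y x, norm_sub_rev z y]
    exact norm_sub_le_norm_sub_add_norm_sub x y z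
  have h7 : ‖x - z‖ ^ 2 ≤ 2 * ‖y - x‖ ^ 2 + 2 * ‖z - y‖ ^ 2 := by
    have := pow_le_pow_left₀ (norm_nonneg _) h6 2
    nlinarith [sq_nonneg (‖y - x‖ - ‖z - y‖)]
  have h8 : μ / 4 * ‖x - z‖ ^ 2 ≤ μ / 4 * (2 * ‖y - x‖ ^ 2 + 2 * ‖z - y‖ ^ 2) := by gcongr
  rw [norm_sub_rev x y] at h2
  linarith

end SmoothConvex

/-- Jensen's inequality for the squared norm. -/
lemma norm_sum_smul_sq_le {ι E : Type*} [NormedAddCommGroup E] [NormedSpace ℝ E] {s : Finset ι}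
    {w : ι → ℝ} (hw : ∀ i ∈ s, 0 ≤ w i) (hw1 : ∑ i ∈ s, w i = 1) (v : ι → E) :
    ‖∑ i ∈ s, w i • v i‖ ^ 2 ≤ ∑ i ∈ s, w i * ‖v i‖ ^ 2 := by
  have h1 : ‖∑ i ∈ s, w i • v i‖ ≤ ∑ i ∈ s, w i * ‖v i‖ := by
    refine (norm_sum_le _ _).trans (Finset.sum_le_sum fun i hi => ?_)
    rw [norm_smul, Real.norm_of_nonneg (hw i hi)]
  exact (pow_le_pow_left₀ (norm_nonneg _) h1 2).trans
    (Real.pow_arith_mean_le_arith_mean_pow s w (fun i => ‖v i‖) hw hw1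
      (fun i _ => norm_nonneg _) 2)

/-! ### The global objective -/

namespace FedAvg

variable {n d : ℕ} (A : FedAvg n d) {L μ : ℝ} {xstar : Vec d}

lemma hasGradientAt_obj (hsmooth : ∀ i, LSmooth L (A.f i)) (x : Vec d) :
    HasGradientAt A.obj (∑ i, A.w i • gradient (A.f i) x) x := by
  rw [hasGradientAt_iff_hasFDerivAt, map_sum]
  refine (HasFDerivAt.fun_sum (u := Finset.univ) (A := fun i x => A.w i * A.f i x)
    fun i _ => ?_)
  simpa using ((hsmooth i).hasGradientAt x).hasFDerivAt.const_mul (A.w i)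

lemma sum_smul_gradient_eq_zero (hsmooth : ∀ i, LSmooth L (A.f i))
    (hstar : ∀ z, A.obj xstar ≤ A.obj z) : ∑ i, A.w i • gradient (A.f i) xstar = 0 := by
  have h1 : IsLocalMin A.obj xstar := Filter.Eventually.of_forall hstar
  have h2 := h1.hasFDerivAt_eq_zero (A.hasGradientAt_obj hsmooth xstar).hasFDerivAt
  exact (InnerProductSpace.toDual ℝ (Vec d)).map_eq_zero_iff.1 h2

/-- At the minimizer the weighted gradients cancel, so that the weighted Bregman divergences add
up to the suboptimality. -/
lemma sum_bregman (hsmooth : ∀ i, LSmooth L (A.f i))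
    (hstar : ∀ z, A.obj xstar ≤ A.obj z) (x : Vec d) :
    ∑ i, A.w i * bregman (A.f i) x xstar = A.obj x - A.obj xstar := by
  have h1 : ∑ i, A.w i * inner ℝ (gradient (A.f i) xstar) (x - xstar) = 0 := by
    have := congrArg (fun v => inner ℝ v (x - xstar)) (A.sum_smul_gradient_eq_zero hsmooth hstar)
    simpa [sum_inner, inner_smul_left] using this
  simp only [bregman, obj, mul_sub, Finset.sum_sub_distrib] at h1 ⊢
  linarith

lemma norm_sum_gradient_sq_le (hL : 0 < L) (hμ : 0 < μ) (hw : ∀ i, 0 ≤ A.w i)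
    (hw1 : ∑ i, A.w i = 1) (hsmooth : ∀ i, LSmooth L (A.f i))
    (hconv : ∀ i, GradStronglyConvex μ (A.f i)) (hstar : ∀ z, A.obj xstar ≤ A.obj z)
    (x : Vec d) :
    ‖∑ i, A.w i • gradient (A.f i) x‖ ^ 2 ≤ 2 * L * (A.obj x - A.obj xstar) := by
  have h1 : ∑ i, A.w i • gradient (A.f i) x =
      ∑ i, A.w i • (gradient (A.f i) x - gradient (A.f i) xstar) := by
    simp only [smul_sub, Finset.sum_sub_distrib, A.sum_smul_gradient_eq_zero hsmooth hstar,
      sub_zero]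
  rw [h1, ← A.sum_bregman hsmooth hstar, Finset.mul_sum]
  refine (norm_sum_smul_sq_le (fun i _ => hw i) hw1 _).trans (Finset.sum_le_sum fun i _ => ?_)
  have := mul_le_mul_of_nonneg_left
    ((hsmooth i).norm_gradient_sub_sq_le hL (hconv i) hμ x xstar) (hw i)
  linarith

end FedAvg

/-! ### Independent sampling -/

section Sampling

variable {n d : ℕ}

lemma independentSamplingProb_nonneg {p : Fin n → ℝ} (h0 : ∀ i, 0 ≤ p i) (h1 : ∀ i, p i ≤ 1)
    (A : Finset (Fin n)) : 0 ≤ independentSamplingProb p A :=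
  mul_nonneg (Finset.prod_nonneg fun i _ => h0 i)
    (Finset.prod_nonneg fun i _ => sub_nonneg.2 (h1 i))

lemma samplingVariance_nonneg {p : Fin n → ℝ} (h0 : ∀ i, 0 ≤ p i) (h1 : ∀ i, p i ≤ 1)
    (v : Fin n → Vec d) : 0 ≤ samplingVariance p v :=
  Finset.sum_nonneg fun A _ => mul_nonneg (independentSamplingProb_nonneg h0 h1 A) (sq_nonneg _)

/-- The probability that the independent sampling contains `T` is `∏ i ∈ T, p i`: expand
`∏ i, (p i + q i)`, where `q` is `1 - p` outside `T` and `0` on `T`. -/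
lemma sum_independentSamplingProb_superset (p : Fin n → ℝ) (T : Finset (Fin n)) :
    ∑ A : Finset (Fin n), independentSamplingProb p A * (if T ⊆ A then 1 else 0) =
      ∏ i ∈ T, p i := by
  have h1 := Fintype.prod_add p (fun i => if i ∈ T then 0 else 1 - p i)
  have h2 : ∏ i, (p i + if i ∈ T then 0 else 1 - p i) = ∏ i ∈ T, p i := by
    rw [← Finset.prod_subset (Finset.subset_univ T)]
    · exact Finset.prod_congr rfl fun i hi => by simp [hi]
    · intro i _ hi
      simp [hi]
  rw [← h2, h1]
  refine Finset.sum_congr rfl fun A _ => ?_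
  rw [independentSamplingProb, mul_assoc]
  congr 1
  split_ifs with h
  · rw [mul_one]
    refine Finset.prod_congr rfl fun i hi => ?_
    rw [if_neg fun hT => Finset.mem_compl.1 hi (h hT)]
  · obtain ⟨i, hiT, hiA⟩ := Finset.not_subset.1 h
    rw [mul_zero]
    refine (Finset.prod_eq_zero (i := i) (Finset.mem_compl.2 hiA) ?_).symm
    exact if_pos hiT

lemma sum_independentSamplingProb (p : Fin n → ℝ) :
    ∑ A : Finset (Fin n), independentSamplingProb p A = 1 := by
  simpa using sum_independentSamplingProb_superset p ∅

/-- The covariances of the normalized inclusion indicators. -/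
lemma sum_independentSamplingProb_mul_mul (p : Fin n → ℝ) {i j : Fin n} (hi : p i ≠ 0)
    (hj : p j ≠ 0) :
    ∑ A : Finset (Fin n), independentSamplingProb p A *
      (((if i ∈ A then (p i)⁻¹ else 0) - 1) * ((if j ∈ A then (p j)⁻¹ else 0) - 1)) =
      if i = j then (p i)⁻¹ - 1 else 0 := by
  have e : ∀ A : Finset (Fin n), independentSamplingProb p A *
      (((if i ∈ A then (p i)⁻¹ else 0) - 1) * ((if j ∈ A then (p j)⁻¹ else 0) - 1)) =
      (p i)⁻¹ * (p j)⁻¹ * (independentSamplingProb p A * (if {i, j} ⊆ A then 1 else 0)) -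
      (p i)⁻¹ * (independentSamplingProb p A * (if {i} ⊆ A then 1 else 0)) -
      (p j)⁻¹ * (independentSamplingProb p A * (if {j} ⊆ A then 1 else 0)) +
      independentSamplingProb p A := by
    intro A
    by_cases h1 : i ∈ A <;> by_cases h2 : j ∈ A <;>
      simp [h1, h2, Finset.insert_subset_iff] <;> ring
  simp only [e, Finset.sum_add_distrib, Finset.sum_sub_distrib, ← Finset.mul_sum,
    sum_independentSamplingProb_superset, sum_independentSamplingProb]
  split_ifs with h
  · subst h
    simp
    field_simp
    ring
  · rw [Finset.prod_pair h]
    simp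
    field_simp
    ring

/-- The expectation of a sampled sum is the full sum. -/
lemma sum_independentSamplingProb_smul {p : Fin n → ℝ} {v : Fin n → Vec d}
    (hv : ∀ i, p i = 0 → v i = 0) :
    ∑ A : Finset (Fin n), independentSamplingProb p A • ∑ i ∈ A, (p i)⁻¹ • v i = ∑ i, v i := by
  have e : ∀ A : Finset (Fin n), independentSamplingProb p A • ∑ i ∈ A, (p i)⁻¹ • v i =
      ∑ i, (independentSamplingProb p A * (if {i} ⊆ A then 1 else 0)) • (p i)⁻¹ • v i := by
    intro A
    simp [Finset.smul_sum, mul_ite, ite_smul, Finset.sum_ite_mem]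
  simp only [e]
  rw [Finset.sum_comm]
  refine Finset.sum_congr rfl fun i _ => ?_
  rw [← Finset.sum_smul, sum_independentSamplingProb_superset, Finset.prod_singleton, smul_smul]
  by_cases hp : p i = 0
  · simp [hp, hv i hp]
  · rw [mul_inv_cancel₀ hp, one_smul]

lemma samplingVariance_eq {p : Fin n → ℝ} {v : Fin n → Vec d} (hv : ∀ i, p i = 0 → v i = 0) :
    samplingVariance p v = ∑ i, ((p i)⁻¹ - 1) * ‖v i‖ ^ 2 := by
  have e : ∀ A : Finset (Fin n), independentSamplingProb p A *
      ‖(∑ i ∈ A, (p i)⁻¹ • v i) - ∑ i, v i‖ ^ 2 =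
      ∑ i, ∑ j, independentSamplingProb p A *
        (((if i ∈ A then (p i)⁻¹ else 0) - 1) * ((if j ∈ A then (p j)⁻¹ else 0) - 1)) *
        inner ℝ (v i) (v j) := by
    intro A
    have h1 : (∑ i ∈ A, (p i)⁻¹ • v i) - ∑ i, v i =
        ∑ i, ((if i ∈ A then (p i)⁻¹ else 0) - 1) • v i := by
      simp [sub_smul, ite_smul, Finset.sum_ite_mem]
    rw [h1, ← real_inner_self_eq_norm_sq, sum_inner, Finset.mul_sum]
    refine Finset.sum_congr rfl fun i _ => ?_
    rw [inner_sum, Finset.mul_sum]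
    refine Finset.sum_congr rfl fun j _ => ?_
    rw [real_inner_smul_left, real_inner_smul_right]
    ring
  simp only [samplingVariance, e]
  rw [Finset.sum_comm]
  refine Finset.sum_congr rfl fun i _ => ?_
  rw [Finset.sum_comm, Finset.sum_eq_single i]
  · rw [← Finset.sum_mul, real_inner_self_eq_norm_sq]
    by_cases hi : p i = 0
    · simp [hv i hi]
    · rw [sum_independentSamplingProb_mul_mul p hi hi, if_pos rfl]
  · intro j _ hji
    rw [← Finset.sum_mul]
    by_cases hi : p i = 0
    · simp [hv i hi]
    by_cases hj : p j = 0
    · simp [hv j hj]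
    rw [sum_independentSamplingProb_mul_mul p hi hj, if_neg (Ne.symm hji), zero_mul]
  · simp

/-- The bias-variance decomposition of a step along a sampled sum. -/
lemma sum_independentSamplingProb_mul_norm_sub_sq {p : Fin n → ℝ} {v : Fin n → Vec d}
    (hv : ∀ i, p i = 0 → v i = 0) (c : ℝ) (z : Vec d) :
    ∑ A : Finset (Fin n), independentSamplingProb p A *
        ‖z - c • ∑ i ∈ A, (p i)⁻¹ • v i‖ ^ 2 =
      ‖z - c • ∑ i, v i‖ ^ 2 + c ^ 2 * samplingVariance p v := by
  set V := ∑ i, v i with hV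
  have e : ∀ A : Finset (Fin n), independentSamplingProb p A *
        ‖z - c • ∑ i ∈ A, (p i)⁻¹ • v i‖ ^ 2 =
      independentSamplingProb p A * ‖z - c • V‖ ^ 2 -
      2 * c * (inner ℝ (z - c • V) (independentSamplingProb p A • ∑ i ∈ A, (p i)⁻¹ • v i) -
        independentSamplingProb p A * inner ℝ (z - c • V) V) +
      c ^ 2 * (independentSamplingProb p A * ‖(∑ i ∈ A, (p i)⁻¹ • v i) - V‖ ^ 2) := by
    intro A
    have h1 : z - c • ∑ i ∈ A, (p i)⁻¹ • v i =
        (z - c • V) - c • ((∑ i ∈ A, (p i)⁻¹ • v i) - V) := by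
      rw [smul_sub]; abel
    rw [h1, norm_sub_sq_real, inner_smul_right, inner_smul_right, inner_sub_right, norm_smul,
      mul_pow, Real.norm_eq_abs, sq_abs]
    ring
  simp only [e, Finset.sum_add_distrib, Finset.sum_sub_distrib, ← Finset.mul_sum,
    ← Finset.sum_mul, sum_independentSamplingProb, samplingVariance, ← inner_sum,
    sum_independentSamplingProb_smul hv, ← hV]
  ring

end Sampling

/-! ### The optimal inclusion probabilities -/

section OptimalProbabilities

variable {n m : ℕ} {u : Fin n → ℝ}

lemma orderStat_succ (u : Fin n → ℝ) (j : Fin n) :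
    orderStat u (j + 1) = u (Tuple.sort u j) := by
  simp [orderStat]

lemma exists_eq_orderStat (u : Fin n → ℝ) (i : Fin n) :
    ∃ j : Fin n, u i = orderStat u (j + 1) :=
  ⟨(Tuple.sort u).symm i, by rw [orderStat_succ]; simp⟩

lemma orderStat_mono (u : Fin n → ℝ) {i j : ℕ} (hi : 1 ≤ i) (hij : i ≤ j) (hj : j ≤ n) :
    orderStat u i ≤ orderStat u j := by
  obtain ⟨i, rfl⟩ := Nat.exists_eq_add_of_le' hi
  obtain ⟨j, rfl⟩ := Nat.exists_eq_add_of_le' (hi.trans hij)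
  have h1 := orderStat_succ u ⟨i, by omega⟩
  have h2 := orderStat_succ u ⟨j, by omega⟩
  simp only at h1 h2
  rw [h1, h2]
  exact Tuple.monotone_sort u (by simpa using hij)

lemma orderStat_nonneg (hu : ∀ i, 0 ≤ u i) (j : ℕ) : 0 ≤ orderStat u j := by
  unfold orderStat
  split_ifs
  exacts [hu _, le_rfl]

lemma lowerSum_nonneg (hu : ∀ i, 0 ≤ u i) (l : ℕ) : 0 ≤ lowerSum u l :=
  Finset.sum_nonneg fun j _ => orderStat_nonneg hu j

lemma orderStat_le_lowerSum (hu : ∀ i, 0 ≤ u i) {j l : ℕ} (hj : 1 ≤ j) (hjl : j ≤ l) :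
    orderStat u j ≤ lowerSum u l :=
  Finset.single_le_sum (f := orderStat u) (fun i _ => orderStat_nonneg hu i)
    (Finset.mem_Icc.2 ⟨hj, hjl⟩)

lemma lowerSum_card (u : Fin n → ℝ) : lowerSum u n = ∑ i, u i := by
  rw [← Equiv.sum_comp (Tuple.sort u) u]
  simp_rw [← orderStat_succ]
  rw [lowerSum, Fin.sum_univ_eq_sum_range (fun j => orderStat u (j + 1)) n,
    Finset.range_eq_Ico, Finset.sum_Ico_add' (orderStat u) 0 n 1, zero_add]
  rfl

lemma lowerSum_le (hu : ∀ i, 0 ≤ u i) {l : ℕ} (hl : l ≤ n) : lowerSum u l ≤ ∑ i, u i := by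
  rw [← lowerSum_card]
  exact Finset.sum_le_sum_of_subset_of_nonneg (Finset.Icc_subset_Icc_right hl)
    fun i _ _ => orderStat_nonneg hu i

lemma ocsIndex_le : ocsIndex m u ≤ n := Nat.findGreatest_le n

/-- The defining condition of the index `l` is met, since it holds for `l = n - m + 1`. -/
lemma ocsIndex_spec (hm : 1 ≤ m) (hmn : m ≤ n) (hu : ∀ i, 0 ≤ u i) :
    n < m + ocsIndex m u ∧
      ((m : ℝ) + ocsIndex m u - n) * orderStat u (ocsIndex m u) ≤ lowerSum u (ocsIndex m u) := by
  classical
  refine Nat.findGreatest_spec (m := n - m + 1)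
    (P := fun l => n < m + l ∧ ((m : ℝ) + l - n) * orderStat u l ≤ lowerSum u l)
    (by omega) ⟨by omega, ?_⟩
  have h1 : (m : ℝ) + (n - m + 1 : ℕ) - n = 1 := by
    rw [Nat.cast_add, Nat.cast_sub hmn]
    push_cast
    ring
  rw [h1, one_mul]
  exact orderStat_le_lowerSum hu (by omega) le_rfl

lemma one_le_ocsFactor (hm : 1 ≤ m) (hmn : m ≤ n) (hu : ∀ i, 0 ≤ u i) :
    1 ≤ (m : ℝ) + ocsIndex m u - n := by
  have h := (ocsIndex_spec hm hmn hu).1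
  have : (n : ℝ) + 1 ≤ m + ocsIndex m u := by exact_mod_cast h
  linarith

/-- A client outside the first branch of the optimal probabilities belongs to the lower part. -/
lemma le_orderStat_ocsIndex {i : Fin n}
    (hi : ¬ (ocsIndex m u < n ∧ orderStat u (ocsIndex m u + 1) ≤ u i)) :
    ∃ j, 1 ≤ j ∧ j ≤ ocsIndex m u ∧ u i = orderStat u j := by
  obtain ⟨j, hj⟩ := exists_eq_orderStat u i
  refine ⟨j + 1, by omega, ?_, hj⟩
  by_contra hlt
  have hjn := j.isLt
  refine hi ⟨by omega, ?_⟩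
  rw [hj]
  exact orderStat_mono u (by omega) (by omega) (by omega)

lemma ocsProb_nonneg (hm : 1 ≤ m) (hmn : m ≤ n) (hu : ∀ i, 0 ≤ u i) (i : Fin n) :
    0 ≤ ocsProb m u i := by
  unfold ocsProb
  split_ifs
  · exact zero_le_one
  · exact div_nonneg (mul_nonneg (zero_le_one.trans (one_le_ocsFactor hm hmn hu)) (hu i))
      (lowerSum_nonneg hu _)

lemma ocsProb_le_one (hm : 1 ≤ m) (hmn : m ≤ n) (hu : ∀ i, 0 ≤ u i) (i : Fin n) :
    ocsProb m u i ≤ 1 := by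
  unfold ocsProb
  split_ifs with h
  · exact le_rfl
  · obtain ⟨j, hj1, hjl, hij⟩ := le_orderStat_ocsIndex h
    refine div_le_one_of_le₀ (le_trans ?_ (ocsIndex_spec hm hmn hu).2) (lowerSum_nonneg hu _)
    rw [hij]
    exact mul_le_mul_of_nonneg_left (orderStat_mono u hj1 hjl ocsIndex_le)
      (zero_le_one.trans (one_le_ocsFactor hm hmn hu))

lemma ocsProb_pos (hm : 1 ≤ m) (hmn : m ≤ n) (hu : ∀ i, 0 ≤ u i) {i : Fin n} (hi : 0 < u i) :
    0 < ocsProb m u i := by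
  unfold ocsProb
  split_ifs with h
  · exact zero_lt_one
  · obtain ⟨j, hj1, hjl, hij⟩ := le_orderStat_ocsIndex h
    exact div_pos (mul_pos (zero_lt_one.trans_le (one_le_ocsFactor hm hmn hu)) hi)
      (hi.trans_le (hij.le.trans (orderStat_le_lowerSum hu hj1 hjl)))

/-- A small inclusion probability is matched by a small update, which keeps the sampled updates
square integrable. -/
lemma inv_ocsProb_mul_sq_le (hm : 1 ≤ m) (hmn : m ≤ n) (hu : ∀ i, 0 ≤ u i) (i : Fin n) :
    (ocsProb m u i)⁻¹ * u i ^ 2 ≤ u i * ∑ j, u j := by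
  have hsum : u i ≤ ∑ j, u j := Finset.single_le_sum (fun j _ => hu j) (Finset.mem_univ i)
  unfold ocsProb
  split_ifs with h
  · rw [inv_one, one_mul, sq]
    exact mul_le_mul_of_nonneg_left hsum (hu i)
  · rcases (hu i).eq_or_lt with h0 | h0
    · simp [← h0]
    · have hf := one_le_ocsFactor (u := u) hm hmn hu
      have hf0 : (0 : ℝ) < (m : ℝ) + ocsIndex m u - n := zero_lt_one.trans_le hf
      rw [inv_div, div_mul_eq_mul_div, div_le_iff₀ (mul_pos hf0 h0)]
      have h1 := lowerSum_le hu (ocsIndex_le (m := m) (u := u))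
      have h2 := lowerSum_nonneg hu (ocsIndex m u)
      calc lowerSum u (ocsIndex m u) * u i ^ 2 ≤ 1 * ((∑ j, u j) * u i ^ 2) := by
            rw [one_mul]; gcongr
        _ ≤ ((m : ℝ) + ocsIndex m u - n) * ((∑ j, u j) * u i ^ 2) := by
            have : 0 ≤ (∑ j, u j) * u i ^ 2 := mul_nonneg (h2.trans h1) (sq_nonneg _)
            gcongr
        _ = u i * (∑ j, u j) * (((m : ℝ) + ocsIndex m u - n) * u i) := by ring

/-- If all clients may communicate, then those with a nonzero update do so with probability one:
the `l` smallest values have their maximum as their mean, hence are equal. -/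
lemma ocsProb_card_eq_one (hn : 1 ≤ n) (hu : ∀ i, 0 ≤ u i) {i : Fin n} (hi : 0 < u i) :
    ocsProb n u i = 1 := by
  unfold ocsProb
  split_ifs with h
  · rfl
  · obtain ⟨j, hj1, hjl, hij⟩ := le_orderStat_ocsIndex h
    have hspec := (ocsIndex_spec hn le_rfl hu).2
    set l := ocsIndex n u with hl
    rw [add_sub_cancel_left] at hspec ⊢
    have hle : ∀ s ∈ Finset.Icc 1 l, orderStat u s ≤ orderStat u l := fun s hs =>
      orderStat_mono u (Finset.mem_Icc.1 hs).1 (Finset.mem_Icc.1 hs).2 ocsIndex_le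
    have hsum : ∑ s ∈ Finset.Icc 1 l, orderStat u s = ∑ _s ∈ Finset.Icc 1 l, orderStat u l := by
      refine le_antisymm (Finset.sum_le_sum hle) ?_
      simpa [lowerSum] using hspec
    have hj := (Finset.sum_eq_sum_iff_of_le hle).1 hsum j (Finset.mem_Icc.2 ⟨hj1, hjl⟩)
    have hlow : lowerSum u l = l * u i := by
      rw [lowerSum, hsum, hij, hj]
      simp
    rw [hlow]
    have : (0 : ℝ) < l := by exact_mod_cast hj1.trans hjl
    exact div_self (by positivity)

lemma measurable_sort (n : ℕ) :
    @Measurable (Fin n → ℝ) (Equiv.Perm (Fin n)) _ ⊤ (fun u => Tuple.sort u) := by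
  let _ : MeasurableSpace (Equiv.Perm (Fin n)) := ⊤
  have _ : MeasurableSingletonClass (Equiv.Perm (Fin n)) := ⟨fun _ => trivial⟩
  refine measurable_to_countable' fun s => ?_
  have e : (fun u : Fin n → ℝ => Tuple.sort u) ⁻¹' {s} =
      {u | (∀ i j, i ≤ j → u (s i) ≤ u (s j)) ∧
        ∀ i j, i < j → u (s i) = u (s j) → s i < s j} := by
    ext u
    simp only [Set.mem_preimage, Set.mem_singleton_iff, Set.mem_ofPred_eq]
    rw [eq_comm, Tuple.eq_sort_iff]
    rfl
  rw [e]
  measurability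

lemma measurable_orderStat (j : ℕ) : Measurable fun u : Fin n → ℝ => orderStat u j := by
  unfold orderStat
  split_ifs with h
  · let _ : MeasurableSpace (Equiv.Perm (Fin n)) := ⊤
    have h1 : Measurable fun q : Equiv.Perm (Fin n) × (Fin n → ℝ) => q.2 (q.1 ⟨j - 1, h⟩) :=
      measurable_from_prod_countable_right fun s => measurable_pi_apply (s ⟨j - 1, h⟩)
    exact h1.comp ((measurable_sort n).prodMk measurable_id)
  · exact measurable_const

lemma measurable_lowerSum (l : ℕ) : Measurable fun u : Fin n → ℝ => lowerSum u l :=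
  Finset.measurable_fun_sum _ fun j _ => measurable_orderStat j

lemma measurable_ocsIndex (m : ℕ) : Measurable fun u : Fin n → ℝ => ocsIndex m u := by
  classical
  unfold ocsIndex
  refine measurable_findGreatest fun l _ => ?_
  exact (MeasurableSet.const _).inter
    (measurableSet_le ((measurable_orderStat l).const_mul _) (measurable_lowerSum l))

lemma measurable_ocsProb (m : ℕ) (i : Fin n) :
    Measurable fun u : Fin n → ℝ => ocsProb m u i := by
  have h1 : Measurable fun q : ℕ × (Fin n → ℝ) =>
      if q.1 < n ∧ orderStat q.2 (q.1 + 1) ≤ q.2 i then (1 : ℝ)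
      else ((m : ℝ) + q.1 - n) * q.2 i / lowerSum q.2 q.1 := by
    refine measurable_from_prod_countable_right fun l => ?_
    have hs : MeasurableSet {u : Fin n → ℝ | l < n ∧ orderStat u (l + 1) ≤ u i} :=
      (MeasurableSet.const _).inter
        (measurableSet_le (measurable_orderStat _) (measurable_pi_apply i))
    have hf : Measurable fun u : Fin n → ℝ => ((m : ℝ) + l - n) * u i / lowerSum u l :=
      ((measurable_pi_apply i).const_mul _).div (measurable_lowerSum l)
    exact Measurable.ite hs measurable_const hf
  exact h1.comp ((measurable_ocsIndex m).prodMk measurable_id)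

end OptimalProbabilities

/-! ### Conditional expectations -/

section CondExp

variable {Ω E : Type*} {m mΩ : MeasurableSpace Ω} {P : Measure Ω}

lemma MeasureTheory.MemLp.integrable_inner_of_two [NormedAddCommGroup E] [InnerProductSpace ℝ E]
    {X Y : Ω → E} (hX : MemLp X 2 P) (hY : MemLp Y 2 P) :
    Integrable (fun ω => inner ℝ (X ω) (Y ω)) P := by
  refine Integrable.mono' (hX.norm.integrable_mul hY.norm) (hX.1.inner hY.1) ?_
  exact ae_of_all _ fun ω => norm_inner_le_norm _ _

lemma MeasureTheory.MemLp.integrable_norm_sq [NormedAddCommGroup E] {X : Ω → E} (hX : MemLp X 2 P) :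
    Integrable (fun ω => ‖X ω‖ ^ 2) P :=
  (memLp_two_iff_integrable_sq_norm hX.1).1 hX

lemma integral_norm_sum_sq_of_orthogonal [NormedAddCommGroup E] [InnerProductSpace ℝ E]
    {ι : Type*} {T : Finset ι} {ζ : ι → Ω → E} (hζ : ∀ a ∈ T, MemLp (ζ a) 2 P)
    (h : ∀ a ∈ T, ∀ b ∈ T, a ≠ b → ∫ ω, inner ℝ (ζ a ω) (ζ b ω) ∂P = 0) :
    ∫ ω, ‖∑ a ∈ T, ζ a ω‖ ^ 2 ∂P = ∑ a ∈ T, ∫ ω, ‖ζ a ω‖ ^ 2 ∂P := by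
  simp only [← real_inner_self_eq_norm_sq, sum_inner, inner_sum]
  rw [integral_finsetSum _ fun a ha => integrable_finsetSum _ fun b hb =>
    (hζ b hb).integrable_inner_of_two (hζ a ha)]
  refine Finset.sum_congr rfl fun a ha => ?_
  rw [integral_finsetSum _ fun b hb => (hζ b hb).integrable_inner_of_two (hζ a ha)]
  exact Finset.sum_eq_single_of_mem a ha fun b hb hba => h b hb a ha hba

/-- The second moment of a sum of a signal `a`, a deviation `δ` and a noise `ζ` that is
uncorrelated with the signal only. -/
lemma integral_norm_add_add_sq_le [NormedAddCommGroup E] [InnerProductSpace ℝ E]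
    {a δ ζ : Ω → E} (ha : MemLp a 2 P) (hδ : MemLp δ 2 P) (hζ : MemLp ζ 2 P)
    (h0 : ∫ ω, inner ℝ (a ω) (ζ ω) ∂P = 0) :
    ∫ ω, ‖a ω + δ ω + ζ ω‖ ^ 2 ∂P ≤ 4 / 3 * ∫ ω, ‖a ω‖ ^ 2 ∂P + 11 * ∫ ω, ‖δ ω‖ ^ 2 ∂P +
      8 / 7 * ∫ ω, ‖ζ ω‖ ^ 2 ∂P := by
  have ia := ha.integrable_norm_sq.const_mul (4 / 3)
  have iδ := hδ.integrable_norm_sq.const_mul 11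
  have iζ := hζ.integrable_norm_sq.const_mul (8 / 7)
  have ic := (MemLp.integrable_inner_of_two ha hζ).const_mul 2
  have key : ∀ ω, ‖a ω + δ ω + ζ ω‖ ^ 2 ≤ 4 / 3 * ‖a ω‖ ^ 2 + 11 * ‖δ ω‖ ^ 2 +
      8 / 7 * ‖ζ ω‖ ^ 2 + 2 * inner ℝ (a ω) (ζ ω) := by
    intro ω
    -- Young's inequality with weight `3` for `⟨a, δ⟩` and weight `7` for `⟨δ, ζ⟩`:
    -- `3 + (1 + 7) = 11` and `1 + 1 / 7 = 8 / 7`.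
    have h1 : 0 ≤ ‖a ω - (3 : ℝ) • δ ω‖ ^ 2 := sq_nonneg _
    have h2 : 0 ≤ ‖ζ ω - (7 : ℝ) • δ ω‖ ^ 2 := sq_nonneg _
    rw [norm_sub_sq_real, inner_smul_right, norm_smul, Real.norm_of_nonneg (by norm_num)] at h1 h2
    rw [norm_add_sq_real, norm_add_sq_real, inner_add_left]
    rw [real_inner_comm] at h2
    linarith
  have i2 : Integrable (fun ω => 4 / 3 * ‖a ω‖ ^ 2 + 11 * ‖δ ω‖ ^ 2) P := ia.add iδ
  have i1 : Integrable (fun ω => 4 / 3 * ‖a ω‖ ^ 2 + 11 * ‖δ ω‖ ^ 2 + 8 / 7 * ‖ζ ω‖ ^ 2) P :=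
    i2.add iζ
  calc ∫ ω, ‖a ω + δ ω + ζ ω‖ ^ 2 ∂P
      ≤ ∫ ω, (4 / 3 * ‖a ω‖ ^ 2 + 11 * ‖δ ω‖ ^ 2 + 8 / 7 * ‖ζ ω‖ ^ 2 +
        2 * inner ℝ (a ω) (ζ ω)) ∂P :=
        integral_mono_of_nonneg (ae_of_all _ fun ω => sq_nonneg _) (i1.add ic) (ae_of_all _ key)
    _ = _ := by
        rw [integral_add i1 ic, integral_add i2 iζ, integral_add ia iδ]
        simp only [integral_const_mul, h0, mul_zero, add_zero]

variable [IsProbabilityMeasure P]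

/-- A centred noise is orthogonal to everything that is known before. -/
lemma integral_inner_eq_zero_of_condExp [NormedAddCommGroup E] [InnerProductSpace ℝ E]
    [CompleteSpace E] (hm : m ≤ mΩ) {X ζ : Ω → E} (hXm : StronglyMeasurable[m] X)
    (hX : MemLp X 2 P) (hζ : MemLp ζ 2 P) (h0 : P[ζ | m] =ᵐ[P] 0) :
    ∫ ω, inner ℝ (X ω) (ζ ω) ∂P = 0 := by
  have hint := MemLp.integrable_inner_of_two hX hζ
  have h1 : P[fun ω => inner ℝ (X ω) (ζ ω) | m] =ᵐ[P] fun ω => inner ℝ (X ω) (P[ζ | m] ω) :=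
    condExp_bilin_of_stronglyMeasurable_left (innerSL ℝ) hXm hint (hζ.integrable (by norm_num))
  have h2 := integral_condExp (μ := P) (m := m) (f := fun ω => inner ℝ (X ω) (ζ ω)) hm
  rw [← h2, integral_congr_ae h1]
  refine integral_eq_zero_of_ae ?_
  filter_upwards [h0] with ω hω
  simp [hω]

/-- If `D` has the conditional probability `q` given `m`, then `q` may replace the indicator of
`D` in the integral of a nonnegative `m`-measurable function. The two sides are the integrals
for two measures that agree on `m`, so that no integrability is needed. -/
lemma setLIntegral_eq_of_condExp_indicator (hm : m ≤ mΩ) {D : Set Ω} (hD : MeasurableSet D)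
    {q : Ω → ℝ} (hq : Measurable q) (hq0 : ∀ ω, 0 ≤ q ω)
    (h : P[D.indicator (fun _ => (1 : ℝ)) | m] =ᵐ[P] q)
    {F : Ω → ENNReal} (hF : Measurable[m] F) :
    ∫⁻ ω in D, F ω ∂P = ∫⁻ ω, ENNReal.ofReal (q ω) * F ω ∂P := by
  have hind : Integrable (D.indicator (fun _ => (1 : ℝ))) P :=
    (integrable_const 1).indicator hD
  have hqi : Integrable q P := integrable_condExp.congr h
  have key : (P.restrict D).trim hm = (P.withDensity fun ω => ENNReal.ofReal (q ω)).trim hm := by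
    refine @Measure.ext _ m _ _ fun s hs => ?_
    rw [trim_measurableSet_eq hm hs, trim_measurableSet_eq hm hs, withDensity_apply _ (hm s hs),
      Measure.restrict_apply (hm s hs),
      ← ofReal_integral_eq_lintegral_ofReal hqi.integrableOn (ae_of_all _ hq0),
      ← integral_congr_ae (ae_restrict_of_ae h), setIntegral_condExp hm hind hs,
      integral_indicator_const (1 : ℝ) hD, smul_eq_mul, mul_one, Measure.real,
      Measure.restrict_apply hD, Set.inter_comm, ENNReal.ofReal_toReal (measure_ne_top _ _)]
  calc ∫⁻ ω in D, F ω ∂P = ∫⁻ ω, F ω ∂((P.restrict D).trim hm) := (lintegral_trim hm hF).symm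
    _ = ∫⁻ ω, F ω ∂(P.withDensity fun ω => ENNReal.ofReal (q ω)) := by
        rw [key, lintegral_trim hm hF]
    _ = _ := lintegral_withDensity_eq_lintegral_mul _ hq.ennreal_ofReal (hF.mono hm le_rfl)

/-- Integrating out a random set `S` that has the conditional law `q` given `m`. -/
lemma lintegral_eq_sum_of_condExp_indicator {ι : Type*} [Fintype ι] (hm : m ≤ mΩ)
    {S : Ω → ι} (hS : ∀ B, MeasurableSet {ω | S ω = B})
    {q : ι → Ω → ℝ} (hq : ∀ B, Measurable (q B)) (hq0 : ∀ B ω, 0 ≤ q B ω)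
    (h : ∀ B, P[Set.indicator {ω | S ω = B} (fun _ => (1 : ℝ)) | m] =ᵐ[P] q B)
    {F : ι → Ω → ℝ} (hF : ∀ B, Measurable[m] (F B)) (hF0 : ∀ B ω, 0 ≤ F B ω) :
    ∫⁻ ω, ENNReal.ofReal (F (S ω) ω) ∂P = ∫⁻ ω, ENNReal.ofReal (∑ B, q B ω * F B ω) ∂P := by
  classical
  have e : ∀ ω, ENNReal.ofReal (F (S ω) ω) =
      ∑ B, Set.indicator {ω | S ω = B} (fun ω => ENNReal.ofReal (F B ω)) ω := by
    intro ω
    simp [Set.indicator_apply]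
  have hFm : ∀ B, Measurable fun ω => ENNReal.ofReal (F B ω) := fun B =>
    ((hF B).mono hm le_rfl).ennreal_ofReal
  simp only [e]
  rw [lintegral_finsetSum _ fun B _ => (hFm B).indicator (hS B)]
  have e2 : ∀ ω, ENNReal.ofReal (∑ B, q B ω * F B ω) =
      ∑ B, ENNReal.ofReal (q B ω) * ENNReal.ofReal (F B ω) := by
    intro ω
    rw [ENNReal.ofReal_sum_of_nonneg fun B _ => mul_nonneg (hq0 B ω) (hF0 B ω)]
    exact Finset.sum_congr rfl fun B _ => ENNReal.ofReal_mul (hq0 B ω)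
  simp only [e2]
  rw [lintegral_finsetSum _ fun B _ => Measurable.fun_mul (hq B).ennreal_ofReal (hFm B)]
  refine Finset.sum_congr rfl fun B _ => ?_
  rw [lintegral_indicator (hS B)]
  exact setLIntegral_eq_of_condExp_indicator hm (hS B) (hq B) (hq0 B) (h B)
    (hF B).ennreal_ofReal

omit [IsProbabilityMeasure P] in
/-- Nonnegative functions with the same Lebesgue integral are integrable together. -/
lemma integrable_and_integral_eq_of_lintegral_eq {F G : Ω → ℝ} (hF : AEStronglyMeasurable F P)
    (hF0 : ∀ ω, 0 ≤ F ω) (hG : Integrable G P) (hG0 : ∀ ω, 0 ≤ G ω)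
    (h : ∫⁻ ω, ENNReal.ofReal (F ω) ∂P = ∫⁻ ω, ENNReal.ofReal (G ω) ∂P) :
    Integrable F P ∧ ∫ ω, F ω ∂P = ∫ ω, G ω ∂P := by
  constructor
  · rw [← lintegral_ofReal_ne_top_iff_integrable hF (ae_of_all _ hF0), h]
    exact (lintegral_ofReal_ne_top_iff_integrable hG.1 (ae_of_all _ hG0)).2 hG
  · rw [integral_eq_lintegral_of_nonneg_ae (ae_of_all _ hF0) hF,
      integral_eq_lintegral_of_nonneg_ae (ae_of_all _ hG0) hG.1, h]

end CondExp

/-! ### Measurability and square integrability of the iterates -/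

lemma LSmooth.memLp_gradient {d : ℕ} {L : ℝ} {h : Vec d → ℝ} (hh : LSmooth L h)
    {Ω : Type*} [MeasurableSpace Ω] {P : Measure Ω} [IsFiniteMeasure P] {Y : Ω → Vec d}
    (hY : MemLp Y 2 P) : MemLp (fun ω => gradient h (Y ω)) 2 P := by
  have h1 : MemLp (fun ω => gradient h (Y ω) - gradient h 0) 2 P := by
    refine MemLp.of_le_mul (c := L) hY ?_ (ae_of_all _ fun ω => ?_)
    · exact (hh.continuous_gradient.comp_aestronglyMeasurable hY.1).sub
        aestronglyMeasurable_const
    · simpa using hh.2 (Y ω) 0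
  simpa [Pi.add_def] using h1.add (memLp_const (gradient h 0))

namespace FedAvg

variable {n d : ℕ} (A : FedAvg n d)

/-- The assumptions on the losses, the weights, the stochastic gradients and the sampling. -/
structure Standing {Ω : Type*} [MeasurableSpace Ω] (P : Measure Ω)
    (ξ : ℕ → Fin n → ℕ → Ω → Vec d) (S : ℕ → Ω → Finset (Fin n)) (K : ℕ) (L μ M σ : ℝ)
    (xstar : Vec d) : Prop where
  one_le_m : 1 ≤ A.m
  m_le : A.m ≤ n
  two_le_R : 2 ≤ A.R
  w_nonneg : ∀ i, 0 ≤ A.w i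
  w_sum : ∑ i, A.w i = 1
  L_pos : 0 < L
  μ_pos : 0 < μ
  M_nonneg : 0 ≤ M
  smooth : ∀ i, LSmooth L (A.f i)
  convex : ∀ i, GradStronglyConvex μ (A.f i)
  minimizer : ∀ z, A.obj xstar ≤ A.obj z
  oracle : A.GradientOracle ξ S P K M σ
  sampling : A.OptimalClientSampling ξ S P K

variable {Ω : Type*} {ξ : ℕ → Fin n → ℕ → Ω → Vec d} {S : ℕ → Ω → Finset (Fin n)} {L : ℝ}

lemma x_succ (k : ℕ) (ω : Ω) :
    A.x ξ S (k + 1) ω = A.x ξ S k ω -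
      A.ηg k • ∑ i ∈ S k ω, (A.p ξ S k i ω)⁻¹ • (A.w i • A.U ξ S k i ω) := by
  simp only [smul_smul, ← div_eq_inv_mul]
  rfl

/-- The stochastic gradient `∇ f_i (y_{i,r}^k) + ξ_{i,r}^k`. -/
def stochGrad (ξ : ℕ → Fin n → ℕ → Ω → Vec d) (S : ℕ → Ω → Finset (Fin n)) (k : ℕ) (i : Fin n)
    (r : ℕ) (ω : Ω) : Vec d :=
  gradient (A.f i) (A.y ξ S k i r ω) + ξ k i r ω

lemma y_zero (k : ℕ) (i : Fin n) (ω : Ω) : A.y ξ S k i 0 ω = A.x ξ S k ω := rfl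

lemma y_succ (k : ℕ) (i : Fin n) (r : ℕ) (ω : Ω) :
    A.y ξ S k i (r + 1) ω = A.y ξ S k i r ω - A.ηl k • A.stochGrad ξ S k i r ω := rfl

lemma y_sub_x (k : ℕ) (i : Fin n) (r : ℕ) (ω : Ω) :
    A.y ξ S k i r ω - A.x ξ S k ω =
      -(A.ηl k • ∑ s ∈ Finset.range r, A.stochGrad ξ S k i s ω) := by
  induction r with
  | zero => simp [y_zero]
  | succ r ih => rw [y_succ, Finset.sum_range_succ, smul_add, neg_add, ← ih]; abel

lemma U_eq (k : ℕ) (i : Fin n) (ω : Ω) :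
    A.U ξ S k i ω = A.ηl k • ∑ s ∈ Finset.range A.R, A.stochGrad ξ S k i s ω := by
  rw [← neg_inj, ← y_sub_x, ← neg_sub, neg_inj]
  rfl

section Measurability

variable {m' : MeasurableSpace Ω} {k : ℕ}

lemma measurable_y (hsmooth : ∀ i, LSmooth L (A.f i)) (hx : Measurable[m'] (A.x ξ S k))
    {i : Fin n} {r : ℕ} (hξ : ∀ s < r, Measurable[m'] (ξ k i s)) :
    Measurable[m'] (A.y ξ S k i r) := by
  induction r with
  | zero => exact hx
  | succ r ih =>
    have hy := ih fun s hs => hξ s (hs.trans r.lt_succ_self)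
    have hg := (hsmooth i).continuous_gradient.measurable.comp hy
    exact hy.sub (Measurable.fun_const_smul (hg.add (hξ r r.lt_succ_self)) (A.ηl k))

lemma measurable_U (hsmooth : ∀ i, LSmooth L (A.f i)) (hx : Measurable[m'] (A.x ξ S k))
    (hξ : ∀ i, ∀ s < A.R, Measurable[m'] (ξ k i s)) (i : Fin n) :
    Measurable[m'] (A.U ξ S k i) :=
  hx.sub (A.measurable_y hsmooth hx fun s hs => hξ i s hs)

lemma measurable_p (hsmooth : ∀ i, LSmooth L (A.f i)) (hx : Measurable[m'] (A.x ξ S k))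
    (hξ : ∀ i, ∀ s < A.R, Measurable[m'] (ξ k i s)) (i : Fin n) :
    Measurable[m'] (A.p ξ S k i) :=
  (measurable_ocsProb A.m i).comp
    (measurable_pi_lambda _ fun j => ((A.measurable_U hsmooth hx hξ j).const_smul (A.w j)).norm)

lemma measurable_x (hsmooth : ∀ i, LSmooth L (A.f i))
    (hξ : ∀ k' < k, ∀ i, ∀ s < A.R, Measurable[m'] (ξ k' i s))
    (hS : ∀ k' < k, ∀ B, MeasurableSet[m'] {ω | S k' ω = B}) : Measurable[m'] (A.x ξ S k) := by
  classical
  induction k with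
  | zero => exact measurable_const
  | succ k ih =>
    have hx := ih (fun k' hk' => hξ k' (hk'.trans k.lt_succ_self))
      fun k' hk' => hS k' (hk'.trans k.lt_succ_self)
    have hξk := hξ k k.lt_succ_self
    have e : A.x ξ S (k + 1) = fun ω => A.x ξ S k ω - A.ηg k • ∑ i,
        if i ∈ S k ω then (A.p ξ S k i ω)⁻¹ • (A.w i • A.U ξ S k i ω) else 0 := by
      ext1 ω
      rw [x_succ, Finset.sum_ite_mem, Finset.univ_inter]
    rw [e]
    refine hx.sub (Measurable.fun_const_smul (Finset.measurable_fun_sum _ fun i _ => ?_) _)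
    refine Measurable.ite ?_ ((A.measurable_p hsmooth hx hξk i).inv.smul
      ((A.measurable_U hsmooth hx hξk i).const_smul (A.w i))) measurable_const
    have e2 : {ω | i ∈ S k ω} = ⋃ B ∈ {B : Finset (Fin n) | i ∈ B}, {ω | S k ω = B} := by
      ext ω
      simp
    rw [e2]
    exact MeasurableSet.biUnion (Set.to_countable _) fun B _ => hS k k.lt_succ_self B

lemma measurable_norm_sampled_step_sq (hx : Measurable[m'] (A.x ξ S k))
    (hU : ∀ i, Measurable[m'] (A.U ξ S k i)) (hp : ∀ i, Measurable[m'] (A.p ξ S k i))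
    (z : Vec d) (B : Finset (Fin n)) :
    Measurable[m'] fun ω => ‖A.x ξ S k ω - z -
      A.ηg k • ∑ i ∈ B, (A.p ξ S k i ω)⁻¹ • (A.w i • A.U ξ S k i ω)‖ ^ 2 := by
  have h1 : Measurable[m'] fun ω => ∑ i ∈ B, (A.p ξ S k i ω)⁻¹ • (A.w i • A.U ξ S k i ω) :=
    Finset.measurable_fun_sum _ fun i _ => (hp i).inv.smul ((hU i).const_smul (A.w i))
  exact ((hx.sub_const z).sub (h1.const_smul (A.ηg k))).norm.pow_const 2

end Measurability

section SigmaAlgebras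

variable (ξ S)

lemma measurable_noise_past {k k' : ℕ} (hk : k' < k) (i : Fin n) {r : ℕ} (hr : r < A.R) :
    Measurable[A.past ξ S k] (ξ k' i r) :=
  measurable_iff_comap_le.2 <| le_sup_of_le_left <| le_iSup₂_of_le k' hk <|
    le_iSup_of_le i <| le_iSup₂_of_le r hr le_rfl

lemma measurableSet_past {k k' : ℕ} (hk : k' < k) (B : Finset (Fin n)) :
    MeasurableSet[A.past ξ S k] {ω | S k' ω = B} := by
  have h : MeasurableSpace.comap (S k') ⊤ ≤ A.past ξ S k :=
    le_sup_of_le_right <| le_iSup₂_of_le k' hk le_rfl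
  exact h _ ⟨{B}, trivial, rfl⟩

lemma measurable_x_past (hsmooth : ∀ i, LSmooth L (A.f i)) (k : ℕ) :
    Measurable[A.past ξ S k] (A.x ξ S k) :=
  A.measurable_x hsmooth (fun _ hk i _ hs => A.measurable_noise_past ξ S hk i hs)
    fun _ hk B => A.measurableSet_past ξ S hk B

lemma measurable_noise_noisePast (k : ℕ) {i j : Fin n} {r s : ℕ} (hs : s < A.R)
    (h : j ≠ i ∨ s < r) : Measurable[A.noisePast ξ S k i r] (ξ k j s) :=
  measurable_iff_comap_le.2 <| le_sup_of_le_right <| le_iSup₂_of_le j s <|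
    le_iSup₂_of_le hs h le_rfl

lemma measurable_x_samplingPast (hsmooth : ∀ i, LSmooth L (A.f i)) (k : ℕ) :
    Measurable[A.samplingPast ξ S k] (A.x ξ S k) :=
  (A.measurable_x_past ξ S hsmooth k).mono le_sup_left le_rfl

lemma measurable_noise_samplingPast (k : ℕ) (j : Fin n) {s : ℕ} (hs : s < A.R) :
    Measurable[A.samplingPast ξ S k] (ξ k j s) :=
  measurable_iff_comap_le.2 <| le_sup_of_le_right <| le_iSup₂_of_le j s <|
    le_iSup_of_le hs le_rfl

end SigmaAlgebras

namespace Standing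

variable {A} [mΩ : MeasurableSpace Ω] {P : Measure Ω} {K : ℕ}
  {μ M σ : ℝ} {xstar : Vec d} (H : A.Standing P ξ S K L μ M σ xstar) {k : ℕ}
include H

lemma R_pos : (0 : ℝ) < A.R := by
  have := H.two_le_R
  exact_mod_cast (by omega : 0 < A.R)

lemma n_pos : (0 : ℝ) < n := by
  exact_mod_cast H.one_le_m.trans H.m_le

lemma past_le (hk : k ≤ K) : A.past ξ S k ≤ mΩ := by
  refine sup_le (iSup₂_le fun k' hk' => iSup_le fun i => iSup₂_le fun r hr => ?_)
    (iSup₂_le fun k' hk' => ?_)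
  · exact measurable_iff_comap_le.1 (H.oracle.measurable k' (hk'.trans_le hk) i r hr)
  · rintro _ ⟨T, -, rfl⟩
    have e : S k' ⁻¹' T = ⋃ B ∈ T, {ω | S k' ω = B} := by
      ext ω
      simp
    rw [e]
    exact MeasurableSet.biUnion T.to_countable fun B _ =>
      H.sampling.measurable k' (hk'.trans_le hk) B

lemma noisePast_le (hk : k < K) (i : Fin n) (r : ℕ) : A.noisePast ξ S k i r ≤ mΩ :=
  sup_le (H.past_le hk.le) <| iSup₂_le fun j s => iSup₂_le fun hs _ =>
    measurable_iff_comap_le.1 (H.oracle.measurable k hk j s hs)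

lemma samplingPast_le (hk : k < K) : A.samplingPast ξ S k ≤ mΩ :=
  sup_le (H.past_le hk.le) <| iSup₂_le fun j s => iSup_le fun hs =>
    measurable_iff_comap_le.1 (H.oracle.measurable k hk j s hs)

lemma measurable_x (hk : k ≤ K) : Measurable (A.x ξ S k) :=
  (A.measurable_x_past ξ S H.smooth k).mono (H.past_le hk) le_rfl

lemma measurable_U_samplingPast (k : ℕ) (i : Fin n) :
    Measurable[A.samplingPast ξ S k] (A.U ξ S k i) :=
  A.measurable_U H.smooth (A.measurable_x_samplingPast ξ S H.smooth k)
    (fun j _ hs => A.measurable_noise_samplingPast ξ S k j hs) i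

lemma measurable_p_samplingPast (k : ℕ) (i : Fin n) :
    Measurable[A.samplingPast ξ S k] (A.p ξ S k i) :=
  A.measurable_p H.smooth (A.measurable_x_samplingPast ξ S H.smooth k)
    (fun j _ hs => A.measurable_noise_samplingPast ξ S k j hs) i

lemma p_nonneg (k : ℕ) (i : Fin n) (ω : Ω) : 0 ≤ A.p ξ S k i ω :=
  ocsProb_nonneg H.one_le_m H.m_le (fun _ => norm_nonneg _) i

lemma p_le_one (k : ℕ) (i : Fin n) (ω : Ω) : A.p ξ S k i ω ≤ 1 :=
  ocsProb_le_one H.one_le_m H.m_le (fun _ => norm_nonneg _) i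

lemma smul_U_eq_zero (k : ℕ) (i : Fin n) (ω : Ω) (h : A.p ξ S k i ω = 0) :
    A.w i • A.U ξ S k i ω = 0 := by
  by_contra hne
  exact (ocsProb_pos (u := fun i => ‖A.w i • A.U ξ S k i ω‖) H.one_le_m H.m_le
    (fun _ => norm_nonneg _) (norm_pos_iff.2 hne)).ne' h

lemma samplingVariance_p_eq (k : ℕ) (ω : Ω) :
    samplingVariance (fun i => A.p ξ S k i ω) (fun i => A.w i • A.U ξ S k i ω) =
      ∑ i, ((A.p ξ S k i ω)⁻¹ - 1) * ‖A.w i • A.U ξ S k i ω‖ ^ 2 :=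
  samplingVariance_eq fun i hi => H.smul_U_eq_zero k i ω hi

lemma samplingVariance_p_nonneg (k : ℕ) (ω : Ω) :
    0 ≤ samplingVariance (fun i => A.p ξ S k i ω) (fun i => A.w i • A.U ξ S k i ω) :=
  samplingVariance_nonneg (fun i => H.p_nonneg k i ω) (fun i => H.p_le_one k i ω) _

variable [IsProbabilityMeasure P]

lemma memLp_y (hk : k < K) (hx : MemLp (A.x ξ S k) 2 P) (i : Fin n) {r : ℕ} (hr : r ≤ A.R) :
    MemLp (A.y ξ S k i r) 2 P := by
  induction r with
  | zero => exact hx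
  | succ r ih =>
    have hy := ih (r.le_succ.trans hr)
    exact hy.sub ((((H.smooth i).memLp_gradient hy).add
      (H.oracle.memLp k hk i r hr)).const_smul (A.ηl k))

lemma memLp_U (hk : k < K) (hx : MemLp (A.x ξ S k) 2 P) (i : Fin n) :
    MemLp (A.U ξ S k i) 2 P :=
  hx.sub (H.memLp_y hk hx i le_rfl)

lemma integrable_samplingVariance_p (hk : k < K) (hx : MemLp (A.x ξ S k) 2 P) :
    Integrable (fun ω =>
      samplingVariance (fun i => A.p ξ S k i ω) (fun i => A.w i • A.U ξ S k i ω)) P := by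
  have hsum : MemLp (fun ω => ∑ i, ‖A.w i • A.U ξ S k i ω‖) 2 P :=
    memLp_finsetSum _ fun i _ => ((H.memLp_U hk hx i).const_smul (A.w i)).norm
  refine Integrable.mono' hsum.integrable_sq ?_ (ae_of_all _ fun ω => ?_)
  · simp only [H.samplingVariance_p_eq]
    refine Measurable.aestronglyMeasurable (Finset.measurable_fun_sum _ fun i _ => ?_)
    have hU := (H.measurable_U_samplingPast k i).mono (H.samplingPast_le hk) le_rfl
    have hp := (H.measurable_p_samplingPast k i).mono (H.samplingPast_le hk) le_rfl
    exact (hp.inv.sub_const 1).mul ((hU.const_smul (A.w i)).norm.pow_const 2)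
  · rw [Real.norm_of_nonneg (H.samplingVariance_p_nonneg k ω), H.samplingVariance_p_eq, sq,
      Finset.sum_mul]
    refine Finset.sum_le_sum fun i _ => le_trans ?_
      (inv_ocsProb_mul_sq_le (u := fun i => ‖A.w i • A.U ξ S k i ω‖) H.one_le_m H.m_le
        (fun _ => norm_nonneg _) i)
    exact mul_le_mul_of_nonneg_right (sub_le_self _ zero_le_one) (sq_nonneg _)

/-- The sampling of a round integrated out: conditionally on the noise, the second moment of the
next iterate splits into that of the step with all clients and the variance of the sampling. -/
lemma lintegral_norm_x_succ_sub_sq (hk : k < K) (z : Vec d) :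
    ∫⁻ ω, ENNReal.ofReal (‖A.x ξ S (k + 1) ω - z‖ ^ 2) ∂P =
      ∫⁻ ω, ENNReal.ofReal (‖A.x ξ S k ω - z - A.ηg k • ∑ i, A.w i • A.U ξ S k i ω‖ ^ 2 +
        A.ηg k ^ 2 * samplingVariance (fun i => A.p ξ S k i ω)
          (fun i => A.w i • A.U ξ S k i ω)) ∂P := by
  have hle := H.samplingPast_le hk
  have hU := H.measurable_U_samplingPast k
  have hp := H.measurable_p_samplingPast k
  have hxm := A.measurable_x_samplingPast ξ S H.smooth k
  let q : Finset (Fin n) → Ω → ℝ := fun B ω => independentSamplingProb (fun i => A.p ξ S k i ω) B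
  let F : Finset (Fin n) → Ω → ℝ := fun B ω =>
    ‖A.x ξ S k ω - z - A.ηg k • ∑ i ∈ B, (A.p ξ S k i ω)⁻¹ • (A.w i • A.U ξ S k i ω)‖ ^ 2
  have hqm : ∀ B, Measurable (q B) := fun B => by
    have hp' := fun i => (hp i).mono hle le_rfl
    exact (Finset.measurable_fun_prod _ fun i _ => hp' i).mul
      (Finset.measurable_fun_prod _ fun i _ => (hp' i).const_sub 1)
  have hFm : ∀ B, Measurable[A.samplingPast ξ S k] (F B) := fun B =>
    A.measurable_norm_sampled_step_sq hxm hU hp z B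
  have hlin := lintegral_eq_sum_of_condExp_indicator (P := P) hle (H.sampling.measurable k hk)
    hqm (fun B ω => independentSamplingProb_nonneg (fun i => H.p_nonneg k i ω)
      (fun i => H.p_le_one k i ω) B)
    (H.sampling.law k hk) hFm (fun B ω => sq_nonneg _)
  have e : ∀ ω, F (S k ω) ω = ‖A.x ξ S (k + 1) ω - z‖ ^ 2 := by
    intro ω
    rw [x_succ, sub_right_comm]
  have e2 : ∀ ω, ∑ B, q B ω * F B ω =
      ‖A.x ξ S k ω - z - A.ηg k • ∑ i, A.w i • A.U ξ S k i ω‖ ^ 2 +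
        A.ηg k ^ 2 * samplingVariance (fun i => A.p ξ S k i ω)
          (fun i => A.w i • A.U ξ S k i ω) := fun ω =>
    sum_independentSamplingProb_mul_norm_sub_sq (fun i hi => H.smul_U_eq_zero k i ω hi) _ _
  simp only [e, e2] at hlin
  exact hlin

lemma memLp_full_step (hk : k < K) (hx : MemLp (A.x ξ S k) 2 P) (z : Vec d) :
    MemLp (fun ω => A.x ξ S k ω - z - A.ηg k • ∑ i, A.w i • A.U ξ S k i ω) 2 P := by
  have h1 : MemLp (fun ω => ∑ i, A.w i • A.U ξ S k i ω) 2 P :=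
    memLp_finsetSum _ fun i _ => (H.memLp_U hk hx i).const_smul (A.w i)
  exact (hx.sub (memLp_const z)).sub (h1.const_smul (A.ηg k))

lemma integral_norm_x_succ_sub_sq (hk : k < K) (hx : MemLp (A.x ξ S k) 2 P) (z : Vec d) :
    Integrable (fun ω => ‖A.x ξ S (k + 1) ω - z‖ ^ 2) P ∧
    ∫ ω, ‖A.x ξ S (k + 1) ω - z‖ ^ 2 ∂P =
      ∫ ω, ‖A.x ξ S k ω - z - A.ηg k • ∑ i, A.w i • A.U ξ S k i ω‖ ^ 2 ∂P +
      A.ηg k ^ 2 * ∫ ω, samplingVariance (fun i => A.p ξ S k i ω)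
        (fun i => A.w i • A.U ξ S k i ω) ∂P := by
  have hsv := (H.integrable_samplingVariance_p hk hx).const_mul (A.ηg k ^ 2)
  have hst := MemLp.integrable_norm_sq (H.memLp_full_step hk hx z)
  have hm : AEStronglyMeasurable (fun ω => ‖A.x ξ S (k + 1) ω - z‖ ^ 2) P :=
    (((H.measurable_x hk).sub_const z).norm.pow_const 2).aestronglyMeasurable
  have := integrable_and_integral_eq_of_lintegral_eq hm
    (fun ω => sq_nonneg _) (hst.add hsv)
    (fun ω => add_nonneg (sq_nonneg _)
      (mul_nonneg (sq_nonneg _) (H.samplingVariance_p_nonneg k ω)))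
    (H.lintegral_norm_x_succ_sub_sq hk z)
  refine ⟨this.1, this.2.trans ?_⟩
  rw [← integral_const_mul]
  exact integral_add hst hsv

lemma memLp_x (hk : k ≤ K) : MemLp (A.x ξ S k) 2 P := by
  induction k with
  | zero => exact memLp_const A.x₀
  | succ k ih =>
    rw [memLp_two_iff_integrable_sq_norm (H.measurable_x hk).aestronglyMeasurable]
    simpa using (H.integral_norm_x_succ_sub_sq hk (ih (k.le_succ.trans hk)) 0).1

end Standing
end FedAvg

/-! ### Moments of the local updates -/

namespace FedAvg

variable {n d : ℕ} (A : FedAvg n d) {Ω : Type*} (ξ : ℕ → Fin n → ℕ → Ω → Vec d)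
  (S : ℕ → Ω → Finset (Fin n)) (k : ℕ) (i : Fin n)

/-- The average of the gradients along the local steps of client `i` in round `k`. -/
def avgGrad (ω : Ω) : Vec d :=
  ∑ r ∈ Finset.range A.R, (A.R : ℝ)⁻¹ • gradient (A.f i) (A.y ξ S k i r ω)

/-- The average of the noise along the local steps of client `i` in round `k`. -/
def avgNoise (ω : Ω) : Vec d := ∑ r ∈ Finset.range A.R, (A.R : ℝ)⁻¹ • ξ k i r ω

/-- The average second moment of the gradients along the local steps. -/
def gradMoment [MeasurableSpace Ω] (P : Measure Ω) : ℝ :=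
  ∑ r ∈ Finset.range A.R, (A.R : ℝ)⁻¹ * ∫ ω, ‖gradient (A.f i) (A.y ξ S k i r ω)‖ ^ 2 ∂P

/-- The average squared distance of the local models from the global model. -/
def drift (ω : Ω) : ℝ :=
  ∑ r ∈ Finset.range A.R, (A.R : ℝ)⁻¹ * ‖A.y ξ S k i r ω - A.x ξ S k ω‖ ^ 2

variable {ξ S k i}

lemma drift_nonneg (ω : Ω) : 0 ≤ A.drift ξ S k i ω :=
  Finset.sum_nonneg fun r _ => by positivity

lemma U_eq_avg (hR : (A.R : ℝ) ≠ 0) (ω : Ω) :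
    A.U ξ S k i ω = (A.R * A.ηl k) • (A.avgGrad ξ S k i ω + A.avgNoise ξ k i ω) := by
  rw [U_eq, avgGrad, avgNoise, ← Finset.smul_sum, ← Finset.smul_sum, ← smul_add,
    ← Finset.sum_add_distrib, smul_smul, mul_right_comm, mul_inv_cancel₀ hR, one_mul]
  rfl

namespace Standing

variable {A} [mΩ : MeasurableSpace Ω] {P : Measure Ω} [IsProbabilityMeasure P] {K : ℕ}
  {L μ M σ : ℝ} {xstar : Vec d} (H : A.Standing P ξ S K L μ M σ xstar)
include H

omit [IsProbabilityMeasure P] in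
lemma sum_inv_R : ∑ _r ∈ Finset.range A.R, (A.R : ℝ)⁻¹ = 1 := by
  rw [Finset.sum_const, Finset.card_range, nsmul_eq_mul, mul_inv_cancel₀ H.R_pos.ne']

lemma memLp_gradient_y (hk : k < K) (j : Fin n) {r : ℕ} (hr : r ≤ A.R) :
    MemLp (fun ω => gradient (A.f j) (A.y ξ S k j r ω)) 2 P :=
  (H.smooth j).memLp_gradient (H.memLp_y hk (H.memLp_x hk.le) j hr)

lemma memLp_gradient_x (hk : k < K) (j : Fin n) :
    MemLp (fun ω => gradient (A.f j) (A.x ξ S k ω)) 2 P :=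
  (H.smooth j).memLp_gradient (H.memLp_x hk.le)

lemma memLp_y_sub_x (hk : k < K) (j : Fin n) {r : ℕ} (hr : r ≤ A.R) :
    MemLp (fun ω => A.y ξ S k j r ω - A.x ξ S k ω) 2 P :=
  (H.memLp_y hk (H.memLp_x hk.le) j hr).sub (H.memLp_x hk.le)

lemma memLp_avgGrad (hk : k < K) (j : Fin n) : MemLp (A.avgGrad ξ S k j) 2 P :=
  memLp_finsetSum _ fun _ hr =>
    (H.memLp_gradient_y hk j (Finset.mem_range.1 hr).le).const_smul (A.R : ℝ)⁻¹

omit [IsProbabilityMeasure P] in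
lemma memLp_avgNoise (hk : k < K) (j : Fin n) : MemLp (A.avgNoise ξ k j) 2 P :=
  memLp_finsetSum _ fun r hr =>
    (H.oracle.memLp k hk j r (Finset.mem_range.1 hr)).const_smul (A.R : ℝ)⁻¹

lemma integrable_drift (hk : k < K) (j : Fin n) : Integrable (A.drift ξ S k j) P :=
  integrable_finsetSum _ fun _ hr =>
    (H.memLp_y_sub_x hk j (Finset.mem_range.1 hr).le).integrable_norm_sq.const_mul _

lemma integral_drift (hk : k < K) (j : Fin n) : ∫ ω, A.drift ξ S k j ω ∂P =
    ∑ r ∈ Finset.range A.R, (A.R : ℝ)⁻¹ * ∫ ω, ‖A.y ξ S k j r ω - A.x ξ S k ω‖ ^ 2 ∂P := by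
  simp only [drift]
  rw [integral_finsetSum _ fun r hr =>
    (H.memLp_y_sub_x hk j (Finset.mem_range.1 hr).le).integrable_norm_sq.const_mul _]
  simp only [integral_const_mul]

/-- The noise of a local step is orthogonal to everything that is known before this step or
belongs to the other clients. -/
lemma integral_inner_noise (hk : k < K) {i : Fin n} {r : ℕ} (hr : r < A.R) {Y : Ω → Vec d}
    (hYm : Measurable[A.noisePast ξ S k i r] Y) (hY : MemLp Y 2 P) :
    ∫ ω, inner ℝ (Y ω) (ξ k i r ω) ∂P = 0 :=
  integral_inner_eq_zero_of_condExp (H.noisePast_le hk i r) hYm.stronglyMeasurable hY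
    (H.oracle.memLp k hk i r hr) (H.oracle.unbiased k hk i r hr)

lemma integral_inner_avgNoise (hk : k < K) {i : Fin n} {Y : Ω → Vec d}
    (hYm : ∀ r < A.R, Measurable[A.noisePast ξ S k i r] Y) (hY : MemLp Y 2 P) :
    ∫ ω, inner ℝ (Y ω) (A.avgNoise ξ k i ω) ∂P = 0 := by
  simp only [avgNoise, inner_sum, inner_smul_right]
  rw [integral_finsetSum _ fun r hr => (MemLp.integrable_inner_of_two hY
    (H.oracle.memLp k hk i r (Finset.mem_range.1 hr))).const_mul _]
  refine Finset.sum_eq_zero fun r hr => ?_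
  rw [integral_const_mul, H.integral_inner_noise hk (Finset.mem_range.1 hr)
    (hYm r (Finset.mem_range.1 hr)) hY, mul_zero]

lemma integral_norm_noise_sq_le (hk : k < K) (i : Fin n) {r : ℕ} (hr : r < A.R) :
    ∫ ω, ‖ξ k i r ω‖ ^ 2 ∂P ≤
      M * ∫ ω, ‖gradient (A.f i) (A.y ξ S k i r ω)‖ ^ 2 ∂P + σ ^ 2 := by
  have hy : MeasurableSpace.comap (A.y ξ S k i r) inferInstance ≤ mΩ :=
    measurable_iff_comap_le.1 <| A.measurable_y H.smooth (H.measurable_x hk.le)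
      fun s hs => H.oracle.measurable k hk i s (hs.trans hr)
  have hg := ((H.memLp_gradient_y hk i hr.le).integrable_norm_sq).const_mul M
  rw [← integral_condExp hy]
  refine (integral_mono_ae integrable_condExp (hg.add (integrable_const (σ ^ 2)))
    (H.oracle.variance k hk i r hr)).trans_eq ?_
  rw [integral_add' hg (integrable_const _), integral_const_mul]
  simp

lemma integral_inner_noise_noise (hk : k < K) (i : Fin n) {r s : ℕ} (hr : r < A.R)
    (hs : s < A.R) (hrs : r ≠ s) : ∫ ω, inner ℝ (ξ k i r ω) (ξ k i s ω) ∂P = 0 := by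
  rcases lt_or_gt_of_ne hrs with h | h
  · exact H.integral_inner_noise hk hs (A.measurable_noise_noisePast ξ S k hr (Or.inr h))
      (H.oracle.memLp k hk i r hr)
  · refine (integral_congr_ae (ae_of_all _ fun ω => real_inner_comm _ _)).trans ?_
    exact H.integral_inner_noise hk hr (A.measurable_noise_noisePast ξ S k hs (Or.inr h))
      (H.oracle.memLp k hk i s hs)

lemma integral_norm_sum_noise_sq (hk : k < K) (i : Fin n) {r : ℕ} (hr : r ≤ A.R) :
    ∫ ω, ‖∑ s ∈ Finset.range r, ξ k i s ω‖ ^ 2 ∂P =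
      ∑ s ∈ Finset.range r, ∫ ω, ‖ξ k i s ω‖ ^ 2 ∂P := by
  have hlt : ∀ s ∈ Finset.range r, s < A.R := fun s hs => (Finset.mem_range.1 hs).trans_le hr
  exact integral_norm_sum_sq_of_orthogonal (fun s hs => H.oracle.memLp k hk i s (hlt s hs))
    fun s hs t ht hst => H.integral_inner_noise_noise hk i (hlt s hs) (hlt t ht) hst

lemma sum_integral_norm_noise_sq_le (hk : k < K) (i : Fin n) :
    ∑ s ∈ Finset.range A.R, ∫ ω, ‖ξ k i s ω‖ ^ 2 ∂P ≤
      A.R * (M * A.gradMoment ξ S k i P + σ ^ 2) := by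
  have hR := H.R_pos
  have e : A.R * (M * A.gradMoment ξ S k i P + σ ^ 2) = ∑ r ∈ Finset.range A.R,
      (M * ∫ ω, ‖gradient (A.f i) (A.y ξ S k i r ω)‖ ^ 2 ∂P + σ ^ 2) := by
    rw [gradMoment, ← Finset.mul_sum, Finset.sum_add_distrib, ← Finset.mul_sum]
    simp only [Finset.sum_const, Finset.card_range, nsmul_eq_mul]
    field_simp
  rw [e]
  exact Finset.sum_le_sum fun r hr => H.integral_norm_noise_sq_le hk i (Finset.mem_range.1 hr)

lemma integral_norm_avgNoise_sq_le (hk : k < K) (i : Fin n) :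
    ∫ ω, ‖A.avgNoise ξ k i ω‖ ^ 2 ∂P ≤
      M / A.R * A.gradMoment ξ S k i P + σ ^ 2 / A.R := by
  have hR := H.R_pos
  simp only [avgNoise, ← Finset.smul_sum, norm_smul, mul_pow]
  rw [integral_const_mul, H.integral_norm_sum_noise_sq hk i le_rfl,
    Real.norm_of_nonneg (by positivity)]
  refine (mul_le_mul_of_nonneg_left (H.sum_integral_norm_noise_sq_le hk i)
    (by positivity)).trans_eq ?_
  field_simp

/-- The noises of different clients are uncorrelated. -/
lemma integral_norm_sum_avgNoise_sq (hk : k < K) :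
    ∫ ω, ‖∑ i, A.w i • A.avgNoise ξ k i ω‖ ^ 2 ∂P =
      ∑ i, A.w i ^ 2 * ∫ ω, ‖A.avgNoise ξ k i ω‖ ^ 2 ∂P := by
  rw [integral_norm_sum_sq_of_orthogonal (ζ := fun i ω => A.w i • A.avgNoise ξ k i ω)
    fun i _ => (H.memLp_avgNoise hk i).const_smul (A.w i)]
  · simp only [norm_smul, mul_pow, integral_const_mul, Real.norm_eq_abs, sq_abs]
  · intro i _ j _ hij
    simp only [inner_smul_left, inner_smul_right, integral_const_mul]
    rw [H.integral_inner_avgNoise hk (fun r _ => ?_) (H.memLp_avgNoise hk i), mul_zero, mul_zero]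
    exact Finset.measurable_fun_sum _ fun s hs => Measurable.fun_const_smul
      (A.measurable_noise_noisePast ξ S k (Finset.mem_range.1 hs) (Or.inl hij)) _

/-- The gradients along the local steps, compared with the one at the start of the round. The
parameter `c` weighs the gradient against the drift. -/
lemma gradMoment_le (hk : k < K) (i : Fin n) {c : ℝ} (hc : 0 < c) :
    A.gradMoment ξ S k i P ≤ (1 + c) * ∫ ω, ‖gradient (A.f i) (A.x ξ S k ω)‖ ^ 2 ∂P +
      (1 + c⁻¹) * (L ^ 2 * ∫ ω, A.drift ξ S k i ω ∂P) := by
  have hR := H.R_pos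
  have h1 : ∀ r ∈ Finset.range A.R, ∫ ω, ‖gradient (A.f i) (A.y ξ S k i r ω)‖ ^ 2 ∂P ≤
      (1 + c) * ∫ ω, ‖gradient (A.f i) (A.x ξ S k ω)‖ ^ 2 ∂P +
      (1 + c⁻¹) * (L ^ 2 * ∫ ω, ‖A.y ξ S k i r ω - A.x ξ S k ω‖ ^ 2 ∂P) := by
    intro r hr
    have hr' := (Finset.mem_range.1 hr).le
    have i1 := (H.memLp_gradient_x hk i).integrable_norm_sq.const_mul (1 + c)
    have i2 := ((H.memLp_y_sub_x hk i hr').integrable_norm_sq.const_mul (L ^ 2)).const_mul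
      (1 + c⁻¹)
    simp only [← integral_const_mul]
    rw [← integral_add i1 i2]
    refine integral_mono (H.memLp_gradient_y hk i hr').integrable_norm_sq (i1.add i2)
      fun ω => ?_
    have h2 := (H.smooth i).2 (A.y ξ S k i r ω) (A.x ξ S k ω)
    set a := gradient (A.f i) (A.x ξ S k ω)
    set b := gradient (A.f i) (A.y ξ S k i r ω)
    have h3 : ‖b‖ ≤ ‖a‖ + ‖b - a‖ := by simpa using norm_add_le a (b - a)
    have h4 := pow_le_pow_left₀ (norm_nonneg _) h2 2
    rw [mul_pow] at h4
    have h5 := pow_le_pow_left₀ (norm_nonneg _) h3 2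
    have h6 : 0 ≤ c⁻¹ * (c * ‖a‖ - ‖b - a‖) ^ 2 := by positivity
    have h7 : c⁻¹ * (c * ‖a‖ - ‖b - a‖) ^ 2 =
        c * ‖a‖ ^ 2 - 2 * ‖a‖ * ‖b - a‖ + c⁻¹ * ‖b - a‖ ^ 2 := by
      field_simp
      ring
    have h8 : (1 + c⁻¹) * ‖b - a‖ ^ 2 ≤
        (1 + c⁻¹) * (L ^ 2 * ‖A.y ξ S k i r ω - A.x ξ S k ω‖ ^ 2) := by gcongr
    change ‖b‖ ^ 2 ≤ (1 + c) * ‖a‖ ^ 2 +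
      (1 + c⁻¹) * (L ^ 2 * ‖A.y ξ S k i r ω - A.x ξ S k ω‖ ^ 2)
    nlinarith
  rw [gradMoment, H.integral_drift hk i]
  refine (Finset.sum_le_sum fun r hr => mul_le_mul_of_nonneg_left (h1 r hr)
    (inv_nonneg.2 hR.le)).trans_eq ?_
  simp only [mul_add, Finset.sum_add_distrib, ← Finset.sum_mul, H.sum_inv_R, one_mul,
    Finset.mul_sum]
  congr 1
  exact Finset.sum_congr rfl fun r _ => by ring

/-- The local models stay close to the global model. -/
lemma integral_drift_le (hk : k < K) (i : Fin n) :
    ∫ ω, A.drift ξ S k i ω ∂P ≤ 2 * (A.R * A.ηl k) ^ 2 *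
      ((1 + M / A.R) * A.gradMoment ξ S k i P + σ ^ 2 / A.R) := by
  have hR := H.R_pos
  have h1 : ∀ r ∈ Finset.range A.R, ∫ ω, ‖A.y ξ S k i r ω - A.x ξ S k ω‖ ^ 2 ∂P ≤
      2 * (A.R * A.ηl k) ^ 2 * ((1 + M / A.R) * A.gradMoment ξ S k i P + σ ^ 2 / A.R) := by
    intro r hr
    have hr' := (Finset.mem_range.1 hr).le
    have hsub : Finset.range r ⊆ Finset.range A.R := Finset.range_subset_range.2 hr'
    have hmem : ∀ s ∈ Finset.range A.R,
        MemLp (fun ω => gradient (A.f i) (A.y ξ S k i s ω)) 2 P :=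
      fun s hs => H.memLp_gradient_y hk i (Finset.mem_range.1 hs).le
    have ig : Integrable (fun ω => A.R * ∑ s ∈ Finset.range A.R,
        ‖gradient (A.f i) (A.y ξ S k i s ω)‖ ^ 2) P :=
      (integrable_finsetSum _ fun s hs => (hmem s hs).integrable_norm_sq).const_mul _
    have hz : MemLp (fun ω => ∑ s ∈ Finset.range r, ξ k i s ω) 2 P :=
      memLp_finsetSum _ fun s hs => H.oracle.memLp k hk i s (Finset.mem_range.1 (hsub hs))
    have hpt : ∀ ω, ‖A.y ξ S k i r ω - A.x ξ S k ω‖ ^ 2 ≤ 2 * A.ηl k ^ 2 *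
        (A.R * ∑ s ∈ Finset.range A.R, ‖gradient (A.f i) (A.y ξ S k i s ω)‖ ^ 2 +
          ‖∑ s ∈ Finset.range r, ξ k i s ω‖ ^ 2) := by
      intro ω
      rw [y_sub_x, norm_neg, norm_smul, mul_pow, Real.norm_eq_abs, sq_abs]
      simp only [stochGrad, Finset.sum_add_distrib]
      set a := ∑ s ∈ Finset.range r, gradient (A.f i) (A.y ξ S k i s ω)
      set b := ∑ s ∈ Finset.range r, ξ k i s ω
      have h2 : ‖a‖ ^ 2 ≤ A.R * ∑ s ∈ Finset.range A.R,
          ‖gradient (A.f i) (A.y ξ S k i s ω)‖ ^ 2 := by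
        have h3 := pow_le_pow_left₀ (norm_nonneg a) (norm_sum_le _ _) 2
        refine h3.trans (sq_sum_le_card_mul_sum_sq.trans ?_)
        rw [Finset.card_range]
        refine mul_le_mul (by exact_mod_cast hr')
          (Finset.sum_le_sum_of_subset_of_nonneg hsub fun _ _ _ => sq_nonneg _)
          (Finset.sum_nonneg fun _ _ => sq_nonneg _) hR.le
      have h4 := pow_le_pow_left₀ (norm_nonneg (a + b)) (norm_add_le a b) 2
      have h5 : ‖a + b‖ ^ 2 ≤ 2 * (‖a‖ ^ 2 + ‖b‖ ^ 2) := by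
        nlinarith [sq_nonneg (‖a‖ - ‖b‖)]
      calc A.ηl k ^ 2 * ‖a + b‖ ^ 2 ≤ A.ηl k ^ 2 * (2 * (‖a‖ ^ 2 + ‖b‖ ^ 2)) := by gcongr
        _ ≤ A.ηl k ^ 2 * (2 * (A.R * ∑ s ∈ Finset.range A.R,
              ‖gradient (A.f i) (A.y ξ S k i s ω)‖ ^ 2 + ‖b‖ ^ 2)) := by gcongr
        _ = _ := by ring
    refine (integral_mono (H.memLp_y_sub_x hk i hr').integrable_norm_sq
      ((ig.add hz.integrable_norm_sq).const_mul (2 * A.ηl k ^ 2)) hpt).trans ?_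
    rw [integral_const_mul, integral_add' ig hz.integrable_norm_sq, integral_const_mul,
      integral_finsetSum _ fun s hs => (hmem s hs).integrable_norm_sq,
      H.integral_norm_sum_noise_sq hk i hr']
    have e : ∑ s ∈ Finset.range A.R, ∫ ω, ‖gradient (A.f i) (A.y ξ S k i s ω)‖ ^ 2 ∂P =
        A.R * A.gradMoment ξ S k i P := by
      rw [gradMoment, ← Finset.mul_sum, ← mul_assoc, mul_inv_cancel₀ hR.ne', one_mul]
    have h6 : ∑ s ∈ Finset.range r, ∫ ω, ‖ξ k i s ω‖ ^ 2 ∂P ≤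
        A.R * (M * A.gradMoment ξ S k i P + σ ^ 2) :=
      (Finset.sum_le_sum_of_subset_of_nonneg hsub fun _ _ _ =>
        integral_nonneg fun _ => sq_nonneg _).trans (H.sum_integral_norm_noise_sq_le hk i)
    rw [e]
    calc 2 * A.ηl k ^ 2 * (A.R * (A.R * A.gradMoment ξ S k i P) +
          ∑ s ∈ Finset.range r, ∫ ω, ‖ξ k i s ω‖ ^ 2 ∂P)
        ≤ 2 * A.ηl k ^ 2 * (A.R * (A.R * A.gradMoment ξ S k i P) +
          A.R * (M * A.gradMoment ξ S k i P + σ ^ 2)) := by gcongr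
      _ = _ := by
        field_simp
        ring
  rw [H.integral_drift hk i]
  refine (Finset.sum_le_sum fun r hr => mul_le_mul_of_nonneg_left (h1 r hr)
    (inv_nonneg.2 hR.le)).trans_eq ?_
  rw [← Finset.sum_mul, H.sum_inv_R, one_mul]

omit [IsProbabilityMeasure P] in
lemma norm_avgGrad_sub_sq_le (i : Fin n) (ω : Ω) :
    ‖A.avgGrad ξ S k i ω - gradient (A.f i) (A.x ξ S k ω)‖ ^ 2 ≤
      L ^ 2 * A.drift ξ S k i ω := by
  have hR := H.R_pos
  have e : A.avgGrad ξ S k i ω - gradient (A.f i) (A.x ξ S k ω) =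
      ∑ r ∈ Finset.range A.R, (A.R : ℝ)⁻¹ •
        (gradient (A.f i) (A.y ξ S k i r ω) - gradient (A.f i) (A.x ξ S k ω)) := by
    simp only [avgGrad, smul_sub, Finset.sum_sub_distrib, ← Finset.sum_smul, H.sum_inv_R,
      one_smul]
  rw [e, drift, Finset.mul_sum]
  refine (norm_sum_smul_sq_le (fun _ _ => inv_nonneg.2 hR.le) H.sum_inv_R _).trans
    (Finset.sum_le_sum fun r _ => ?_)
  have h1 := pow_le_pow_left₀ (norm_nonneg _)
    ((H.smooth i).2 (A.y ξ S k i r ω) (A.x ξ S k ω)) 2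
  rw [mul_left_comm, ← mul_pow]
  gcongr

lemma memLp_avgGrad_sub (hk : k < K) (i : Fin n) :
    MemLp (fun ω => A.avgGrad ξ S k i ω - gradient (A.f i) (A.x ξ S k ω)) 2 P :=
  (H.memLp_avgGrad hk i).sub (H.memLp_gradient_x hk i)

omit [IsProbabilityMeasure P] in
lemma measurable_gradient_x (i j : Fin n) (r : ℕ) :
    Measurable[A.noisePast ξ S k j r] fun ω => gradient (A.f i) (A.x ξ S k ω) :=
  (H.smooth i).continuous_gradient.measurable.comp
    ((A.measurable_x_past ξ S H.smooth k).mono le_sup_left le_rfl)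

lemma integral_norm_update_sq_le (hk : k < K) (i : Fin n) :
    ∫ ω, ‖A.avgGrad ξ S k i ω + A.avgNoise ξ k i ω‖ ^ 2 ∂P ≤
      4 / 3 * ∫ ω, ‖gradient (A.f i) (A.x ξ S k ω)‖ ^ 2 ∂P +
      11 * (L ^ 2 * ∫ ω, A.drift ξ S k i ω ∂P) +
      8 / 7 * ∫ ω, ‖A.avgNoise ξ k i ω‖ ^ 2 ∂P := by
  have h1 := integral_norm_add_add_sq_le (H.memLp_gradient_x hk i) (H.memLp_avgGrad_sub hk i)
    (H.memLp_avgNoise hk i) (H.integral_inner_avgNoise hk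
      (fun r _ => H.measurable_gradient_x i i r) (H.memLp_gradient_x hk i))
  simp only [add_sub_cancel] at h1
  refine h1.trans ?_
  gcongr
  rw [← integral_const_mul]
  exact integral_mono (H.memLp_avgGrad_sub hk i).integrable_norm_sq
    ((H.integrable_drift hk i).const_mul _) fun ω => H.norm_avgGrad_sub_sq_le i ω

lemma integral_norm_sum_update_sq_le (hk : k < K) :
    ∫ ω, ‖∑ i, A.w i • (A.avgGrad ξ S k i ω + A.avgNoise ξ k i ω)‖ ^ 2 ∂P ≤
      4 / 3 * ∫ ω, ‖∑ i, A.w i • gradient (A.f i) (A.x ξ S k ω)‖ ^ 2 ∂P +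
      11 * (L ^ 2 * ∑ i, A.w i * ∫ ω, A.drift ξ S k i ω ∂P) +
      8 / 7 * ∑ i, A.w i ^ 2 * ∫ ω, ‖A.avgNoise ξ k i ω‖ ^ 2 ∂P := by
  have hg : MemLp (fun ω => ∑ i, A.w i • gradient (A.f i) (A.x ξ S k ω)) 2 P :=
    memLp_finsetSum _ fun i _ => (H.memLp_gradient_x hk i).const_smul (A.w i)
  have hd : MemLp (fun ω => ∑ i, A.w i •
      (A.avgGrad ξ S k i ω - gradient (A.f i) (A.x ξ S k ω))) 2 P :=
    memLp_finsetSum _ fun i _ => (H.memLp_avgGrad_sub hk i).const_smul (A.w i)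
  have hz : MemLp (fun ω => ∑ i, A.w i • A.avgNoise ξ k i ω) 2 P :=
    memLp_finsetSum _ fun i _ => (H.memLp_avgNoise hk i).const_smul (A.w i)
  have h0 : ∫ ω, inner ℝ (∑ i, A.w i • gradient (A.f i) (A.x ξ S k ω))
      (∑ i, A.w i • A.avgNoise ξ k i ω) ∂P = 0 := by
    have e : ∀ ω, inner ℝ (∑ i, A.w i • gradient (A.f i) (A.x ξ S k ω))
        (∑ i, A.w i • A.avgNoise ξ k i ω) =
        ∑ j, A.w j * inner ℝ (∑ i, A.w i • gradient (A.f i) (A.x ξ S k ω))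
          (A.avgNoise ξ k j ω) := fun ω => by
      rw [inner_sum]
      simp only [inner_smul_right]
    simp only [e]
    rw [integral_finsetSum _ fun j _ =>
      (MemLp.integrable_inner_of_two hg (H.memLp_avgNoise hk j)).const_mul _]
    refine Finset.sum_eq_zero fun j _ => ?_
    rw [integral_const_mul, H.integral_inner_avgNoise hk (fun r _ => ?_) hg, mul_zero]
    exact Finset.measurable_fun_sum _ fun i _ =>
      Measurable.fun_const_smul (H.measurable_gradient_x i j r) _
  have h1 := integral_norm_add_add_sq_le hg hd hz h0
  rw [H.integral_norm_sum_avgNoise_sq hk] at h1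
  have e : ∀ ω, ∑ i, A.w i • (A.avgGrad ξ S k i ω + A.avgNoise ξ k i ω) =
      ∑ i, A.w i • gradient (A.f i) (A.x ξ S k ω) +
      ∑ i, A.w i • (A.avgGrad ξ S k i ω - gradient (A.f i) (A.x ξ S k ω)) +
      ∑ i, A.w i • A.avgNoise ξ k i ω := by
    intro ω
    simp only [← Finset.sum_add_distrib, ← smul_add, add_sub_cancel]
  simp only [e]
  refine h1.trans ?_
  gcongr
  rw [Finset.mul_sum]
  simp only [← integral_const_mul]
  have hi := fun i => ((H.integrable_drift hk i).const_mul (A.w i)).const_mul (L ^ 2)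
  rw [← integral_finsetSum _ fun i _ => hi i]
  refine integral_mono hd.integrable_norm_sq (integrable_finsetSum _ fun i _ => hi i)
    fun ω => (norm_sum_smul_sq_le (fun i _ => H.w_nonneg i) H.w_sum _).trans
      (Finset.sum_le_sum fun i _ => ?_)
  rw [mul_left_comm]
  exact mul_le_mul_of_nonneg_left (H.norm_avgGrad_sub_sq_le i ω) (H.w_nonneg i)

omit [IsProbabilityMeasure P] in
lemma le_inner_avgGrad (i : Fin n) (z : Vec d) (ω : Ω) :
    A.f i (A.x ξ S k ω) - A.f i z + μ / 4 * ‖A.x ξ S k ω - z‖ ^ 2 -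
      L * A.drift ξ S k i ω ≤ inner ℝ (A.avgGrad ξ S k i ω) (A.x ξ S k ω - z) := by
  have hR := H.R_pos
  have e : A.f i (A.x ξ S k ω) - A.f i z + μ / 4 * ‖A.x ξ S k ω - z‖ ^ 2 -
      L * A.drift ξ S k i ω = ∑ r ∈ Finset.range A.R, (A.R : ℝ)⁻¹ *
        (A.f i (A.x ξ S k ω) - A.f i z + μ / 4 * ‖A.x ξ S k ω - z‖ ^ 2 -
          L * ‖A.y ξ S k i r ω - A.x ξ S k ω‖ ^ 2) := by
    simp only [mul_sub _ _ (L * _), Finset.sum_sub_distrib, ← Finset.sum_mul, H.sum_inv_R,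
      one_mul, drift, Finset.mul_sum, mul_left_comm L]
  rw [e, avgGrad, sum_inner]
  refine Finset.sum_le_sum fun r _ => ?_
  rw [real_inner_smul_left]
  exact mul_le_mul_of_nonneg_left
    ((H.smooth i).le_inner_perturbed (H.convex i) H.μ_pos _ _ _) (inv_nonneg.2 hR.le)

omit [IsProbabilityMeasure P] in
lemma bregman_le (i : Fin n) (x z : Vec d) : bregman (A.f i) x z ≤ L / 2 * ‖x - z‖ ^ 2 := by
  have := (H.smooth i).le_quadratic z x
  unfold bregman
  linarith

lemma integrable_bregman (hk : k < K) (i : Fin n) (z : Vec d) :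
    Integrable (fun ω => bregman (A.f i) (A.x ξ S k ω) z) P := by
  refine Integrable.mono' (((H.memLp_x hk.le).sub (memLp_const z)).integrable_norm_sq.const_mul
    (L / 2)) ?_ (ae_of_all _ fun ω => ?_)
  · have h1 : Continuous fun x => bregman (A.f i) x z :=
      ((H.smooth i).1.continuous.sub continuous_const).sub
        (continuous_const.inner (continuous_id.sub continuous_const))
    exact h1.comp_aestronglyMeasurable (H.memLp_x hk.le).1
  · rw [Real.norm_of_nonneg ((H.convex i).bregman_nonneg H.μ_pos _ _)]
    exact H.bregman_le i _ z

lemma integrable_obj_sub (hk : k < K) :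
    Integrable (fun ω => A.obj (A.x ξ S k ω) - A.obj xstar) P := by
  simp only [← A.sum_bregman H.smooth H.minimizer]
  exact integrable_finsetSum _ fun i _ => (H.integrable_bregman hk i xstar).const_mul _

lemma integral_obj_sub (hk : k < K) :
    ∫ ω, (A.obj (A.x ξ S k ω) - A.obj xstar) ∂P =
      ∑ i, A.w i * ∫ ω, bregman (A.f i) (A.x ξ S k ω) xstar ∂P := by
  simp only [← A.sum_bregman H.smooth H.minimizer]
  rw [integral_finsetSum _ fun i _ => (H.integrable_bregman hk i xstar).const_mul _]
  simp only [integral_const_mul]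

/-- The expected progress of the step with all clients. -/
lemma le_integral_inner_update (hk : k < K) :
    ∫ ω, (A.obj (A.x ξ S k ω) - A.obj xstar) ∂P +
      μ / 4 * ∫ ω, ‖A.x ξ S k ω - xstar‖ ^ 2 ∂P -
      L * ∑ i, A.w i * ∫ ω, A.drift ξ S k i ω ∂P ≤
    ∫ ω, inner ℝ (A.x ξ S k ω - xstar)
      (∑ i, A.w i • (A.avgGrad ξ S k i ω + A.avgNoise ξ k i ω)) ∂P := by
  have hr : MemLp (fun ω => A.x ξ S k ω - xstar) 2 P := (H.memLp_x hk.le).sub (memLp_const _)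
  have hg : MemLp (fun ω => ∑ i, A.w i • A.avgGrad ξ S k i ω) 2 P :=
    memLp_finsetSum _ fun i _ => (H.memLp_avgGrad hk i).const_smul (A.w i)
  have hrm : ∀ j r, Measurable[A.noisePast ξ S k j r] fun ω => A.x ξ S k ω - xstar := fun j r =>
    ((A.measurable_x_past ξ S H.smooth k).mono le_sup_left le_rfl).sub_const xstar
  have hinz : ∀ i ∈ Finset.univ, Integrable (fun ω => A.w i * inner ℝ (A.x ξ S k ω - xstar)
      (A.avgNoise ξ k i ω)) P := fun i _ =>
    (MemLp.integrable_inner_of_two hr (H.memLp_avgNoise hk i)).const_mul _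
  have hz : ∫ ω, ∑ i, A.w i * inner ℝ (A.x ξ S k ω - xstar) (A.avgNoise ξ k i ω) ∂P = 0 := by
    rw [integral_finsetSum _ hinz]
    refine Finset.sum_eq_zero fun i _ => ?_
    rw [integral_const_mul, H.integral_inner_avgNoise hk (fun r _ => hrm i r) hr, mul_zero]
  have e : ∀ ω, inner ℝ (A.x ξ S k ω - xstar)
      (∑ i, A.w i • (A.avgGrad ξ S k i ω + A.avgNoise ξ k i ω)) =
      inner ℝ (A.x ξ S k ω - xstar) (∑ i, A.w i • A.avgGrad ξ S k i ω) +
      ∑ i, A.w i * inner ℝ (A.x ξ S k ω - xstar) (A.avgNoise ξ k i ω) := by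
    intro ω
    simp only [smul_add, Finset.sum_add_distrib, inner_add_right, inner_sum, inner_smul_right]
  have i1 := MemLp.integrable_inner_of_two hr hg
  simp only [e]
  rw [integral_add i1 (integrable_finsetSum _ hinz), hz, add_zero]
  have io := H.integrable_obj_sub hk
  have ir := hr.integrable_norm_sq.const_mul (μ / 4)
  have id := fun i => (H.integrable_drift hk i).const_mul (A.w i)
  have ior : Integrable (fun ω => A.obj (A.x ξ S k ω) - A.obj xstar +
      μ / 4 * ‖A.x ξ S k ω - xstar‖ ^ 2) P := io.add ir
  have ids : Integrable (fun ω => L * ∑ i, A.w i * A.drift ξ S k i ω) P :=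
    (integrable_finsetSum _ fun i _ => id i).const_mul L
  have e2 : ∑ i, A.w i * ∫ ω, A.drift ξ S k i ω ∂P =
      ∫ ω, ∑ i, A.w i * A.drift ξ S k i ω ∂P := by
    rw [integral_finsetSum _ fun i _ => id i]
    simp only [integral_const_mul]
  rw [e2, ← integral_const_mul, ← integral_const_mul, ← integral_add io ir,
    ← integral_sub ior ids]
  refine integral_mono (ior.sub ids) i1 fun ω => ?_
  have h1 : ∑ i, A.w i * (A.f i (A.x ξ S k ω) - A.f i xstar +
      μ / 4 * ‖A.x ξ S k ω - xstar‖ ^ 2 - L * A.drift ξ S k i ω) ≤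
      ∑ i, A.w i * inner ℝ (A.avgGrad ξ S k i ω) (A.x ξ S k ω - xstar) :=
    Finset.sum_le_sum fun i _ =>
      mul_le_mul_of_nonneg_left (H.le_inner_avgGrad i xstar ω) (H.w_nonneg i)
  change A.obj (A.x ξ S k ω) - A.obj xstar + μ / 4 * ‖A.x ξ S k ω - xstar‖ ^ 2 -
    L * ∑ i, A.w i * A.drift ξ S k i ω ≤
    inner ℝ (A.x ξ S k ω - xstar) (∑ i, A.w i • A.avgGrad ξ S k i ω)
  rw [real_inner_comm, sum_inner]
  simp only [real_inner_smul_left]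
  refine le_trans (le_of_eq ?_) h1
  simp only [obj, mul_sub, mul_add, Finset.sum_sub_distrib, Finset.sum_add_distrib,
    ← Finset.sum_mul, H.w_sum, one_mul, Finset.mul_sum, mul_left_comm L]

end Standing
end FedAvg

/-! ### The relative improvement factor -/

namespace FedAvg.Standing

variable {n d : ℕ} {A : FedAvg n d} {Ω : Type*} [mΩ : MeasurableSpace Ω] {P : Measure Ω}
  {ξ : ℕ → Fin n → ℕ → Ω → Vec d} {S : ℕ → Ω → Finset (Fin n)} {K k : ℕ}
  {L μ M σ : ℝ} {xstar : Vec d} (H : A.Standing P ξ S K L μ M σ xstar)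
include H

lemma samplingVariance_uniform (k : ℕ) (ω : Ω) :
    samplingVariance (fun _ => (A.m : ℝ) / n) (fun i => A.w i • A.U ξ S k i ω) =
      ((n : ℝ) - A.m) / A.m * ∑ i, A.w i ^ 2 * ‖A.U ξ S k i ω‖ ^ 2 := by
  have hn := H.n_pos
  have hm : (0 : ℝ) < A.m := by exact_mod_cast H.one_le_m
  rw [samplingVariance_eq fun i hi => absurd hi (by positivity), Finset.mul_sum]
  refine Finset.sum_congr rfl fun i _ => ?_
  rw [norm_smul, mul_pow, Real.norm_eq_abs, sq_abs, inv_div]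
  field_simp

lemma improvement_nonneg (k : ℕ) : 0 ≤ A.improvement ξ S P k := by
  have hn := H.n_pos
  refine div_nonneg (integral_nonneg fun ω => H.samplingVariance_p_nonneg k ω)
    (integral_nonneg fun ω => samplingVariance_nonneg (fun _ => by positivity) (fun _ => ?_) _)
  exact div_le_one_of_le₀ (by exact_mod_cast H.m_le) hn.le

lemma one_div_γ (k : ℕ) :
    1 / A.γ ξ S P k = 1 + A.improvement ξ S P k * (((n : ℝ) - A.m) / A.m) := by
  have hm : (0 : ℝ) < A.m := by exact_mod_cast H.one_le_m
  rw [γ, one_div_div]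
  field_simp
  ring

lemma γ_pos (k : ℕ) : 0 < A.γ ξ S P k := by
  have hm : (0 : ℝ) < A.m := by exact_mod_cast H.one_le_m
  have hmn : (A.m : ℝ) ≤ n := by exact_mod_cast H.m_le
  exact div_pos hm (add_pos_of_nonneg_of_pos
    (mul_nonneg (H.improvement_nonneg k) (sub_nonneg.2 hmn)) hm)

lemma γ_le_one (k : ℕ) : A.γ ξ S P k ≤ 1 := by
  have hm : (0 : ℝ) < A.m := by exact_mod_cast H.one_le_m
  have hmn : (A.m : ℝ) ≤ n := by exact_mod_cast H.m_le
  have := mul_nonneg (H.improvement_nonneg k) (sub_nonneg.2 hmn)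
  exact div_le_one_of_le₀ (by linarith) (by linarith)

/-- The expected variance of the optimal sampling in terms of the improvement factor. If the
variance of the uniform sampling vanishes, then either all clients communicate or all updates are
zero, and the optimal sampling has no variance either. -/
lemma integral_samplingVariance_p [IsProbabilityMeasure P] (hk : k < K) :
    ∫ ω, samplingVariance (fun i => A.p ξ S k i ω) (fun i => A.w i • A.U ξ S k i ω) ∂P =
      (1 / A.γ ξ S P k - 1) * ∑ i, A.w i ^ 2 * ∫ ω, ‖A.U ξ S k i ω‖ ^ 2 ∂P := by
  have hm : (0 : ℝ) < A.m := by exact_mod_cast H.one_le_m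
  have hi : ∀ i ∈ Finset.univ, Integrable (fun ω => A.w i ^ 2 * ‖A.U ξ S k i ω‖ ^ 2) P :=
    fun i _ => (H.memLp_U hk (H.memLp_x hk.le) i).integrable_norm_sq.const_mul _
  have hunif : ∫ ω, samplingVariance (fun _ => (A.m : ℝ) / n)
      (fun i => A.w i • A.U ξ S k i ω) ∂P =
      ((n : ℝ) - A.m) / A.m * ∑ i, A.w i ^ 2 * ∫ ω, ‖A.U ξ S k i ω‖ ^ 2 ∂P := by
    simp only [H.samplingVariance_uniform]
    rw [integral_const_mul, integral_finsetSum _ hi]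
    simp only [integral_const_mul]
  rw [H.one_div_γ, add_sub_cancel_left, mul_assoc, ← hunif, improvement]
  by_cases h0 : ∫ ω, samplingVariance (fun _ => (A.m : ℝ) / n)
      (fun i => A.w i • A.U ξ S k i ω) ∂P = 0
  · rw [h0, mul_zero]
    rw [hunif] at h0
    refine integral_eq_zero_of_ae ?_
    rcases mul_eq_zero.1 h0 with h1 | h1
    · have hmn : A.m = n := by
        have := (div_eq_zero_iff.1 h1).resolve_right hm.ne'
        exact_mod_cast (sub_eq_zero.1 this).symm
      refine ae_of_all _ fun ω => ?_
      change samplingVariance _ _ = 0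
      rw [H.samplingVariance_p_eq]
      refine Finset.sum_eq_zero fun i _ => ?_
      by_cases hU : A.w i • A.U ξ S k i ω = 0
      · simp [hU]
      · have hp : A.p ξ S k i ω = 1 := by
          have := ocsProb_card_eq_one (u := fun i => ‖A.w i • A.U ξ S k i ω‖)
            (hmn ▸ H.one_le_m) (fun _ => norm_nonneg _) (norm_pos_iff.2 hU)
          rw [← this, p, prob, hmn]
          rfl
        rw [hp, inv_one, sub_self, zero_mul]
    · have h2 : ∫ ω, ∑ i, A.w i ^ 2 * ‖A.U ξ S k i ω‖ ^ 2 ∂P = 0 := by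
        rw [integral_finsetSum _ hi]
        simpa only [integral_const_mul] using h1
      rw [integral_eq_zero_iff_of_nonneg (fun ω => Finset.sum_nonneg fun i _ => by positivity)
        (integrable_finsetSum _ hi)] at h2
      filter_upwards [h2] with ω hω
      change samplingVariance _ _ = 0
      rw [H.samplingVariance_p_eq]
      refine Finset.sum_eq_zero fun i _ => ?_
      have := (Finset.sum_eq_zero_iff_of_nonneg fun i _ => by positivity).1 hω i
        (Finset.mem_univ i)
      rw [norm_smul, mul_pow, Real.norm_eq_abs, sq_abs, this, mul_zero]
  · rw [div_mul_cancel₀ _ h0]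

end FedAvg.Standing

/-! ### The recursion -/

/-- The second moment of the update of one client, in which the noise enters with the factor `κ`
and the signal with the factor `κ - 1` of the sampling variance. -/
lemma client_moment_le {e Z G V N L q s g κ : ℝ} (hq : 0 ≤ q)
    (hg : 0 < g) (hg1 : g ≤ 1) (hκg : κ * g = 1) (hV0 : 0 ≤ V)
    (hG : G ≤ 6 * L * e + 3 * L * Z)
    (hN : N ≤ q * (7 / 6 * G + 7 * (L ^ 2 * V)) + s) :
    8 / 7 * N + (κ - 1) * (4 / 3 * G + 11 * (L ^ 2 * V) + 8 / 7 * N) ≤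
      κ * ((q + 1 - g) * (8 * L * e + 4 * L * Z) + 11 * (1 + q) * (L ^ 2 * V) + 8 / 7 * s) := by
  have hκ0 : 0 < κ := by
    by_contra hlt
    have := mul_nonpos_of_nonpos_of_nonneg (not_lt.1 hlt) hg.le
    linarith
  have hc : 0 ≤ q + 1 - g := by linarith
  have h2 : 8 / 7 * N + (κ - 1) * (4 / 3 * G + 11 * (L ^ 2 * V) + 8 / 7 * N) =
      κ * (8 / 7 * N + (1 - g) * (4 / 3 * G + 11 * (L ^ 2 * V))) := by
    linear_combination (4 / 3 * G + 11 * (L ^ 2 * V)) * hκg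
  rw [h2]
  refine mul_le_mul_of_nonneg_left ?_ hκ0.le
  have h4 := mul_le_mul_of_nonneg_left hG hc
  have h5 : 0 ≤ L ^ 2 * V := mul_nonneg (sq_nonneg L) hV0
  have h7 := mul_nonneg hq h5
  have h8 := mul_nonneg hg.le h5
  linarith

/-- The weighted sum of the second moments of the updates of the clients. -/
lemma sum_client_moment_le {ι : Type*} [Fintype ι] {w e Z G V N : ι → ℝ} {W L q s g κ Φ : ℝ}
    (hw : ∀ i, 0 ≤ w i) (hwW : ∀ i, w i ≤ W) (hL : 0 < L) (hq : 0 ≤ q)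
    (hg : 0 < g) (hg1 : g ≤ 1) (hκ0 : 0 ≤ κ) (hκg : κ * g = 1)
    (he : ∀ i, 0 ≤ e i) (hV0 : ∀ i, 0 ≤ V i) (hΦ : Φ = ∑ i, w i * e i)
    (hG : ∀ i, G i ≤ 6 * L * e i + 3 * L * Z i)
    (hN : ∀ i, N i ≤ q * (7 / 6 * G i + 7 * (L ^ 2 * V i)) + s) :
    8 / 7 * ∑ i, w i ^ 2 * N i + (κ - 1) * ∑ i, w i ^ 2 *
        (4 / 3 * G i + 11 * (L ^ 2 * V i) + 8 / 7 * N i) ≤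
      κ * (8 * L * (1 + q) * W) * Φ + κ * (4 * L * (q + 1 - g)) * ∑ i, w i ^ 2 * Z i +
      κ * (11 * (1 + q) * L ^ 2 * W) * ∑ i, w i * V i + κ * (8 / 7 * s) * ∑ i, w i ^ 2 := by
  have hTi : ∀ i, 8 / 7 * (w i ^ 2 * N i) +
      (κ - 1) * (w i ^ 2 * (4 / 3 * G i + 11 * (L ^ 2 * V i) + 8 / 7 * N i)) ≤
      κ * (8 * L * (1 + q) * W) * (w i * e i) + κ * (4 * L * (q + 1 - g)) * (w i ^ 2 * Z i) +
      κ * (11 * (1 + q) * L ^ 2 * W) * (w i * V i) + κ * (8 / 7 * s) * w i ^ 2 := by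
    intro i
    have h9 : w i ^ 2 * e i ≤ W * (w i * e i) := by
      rw [sq, mul_assoc]
      exact mul_le_mul_of_nonneg_right (hwW i) (mul_nonneg (hw i) (he i))
    have h10 : w i ^ 2 * V i ≤ W * (w i * V i) := by
      rw [sq, mul_assoc]
      exact mul_le_mul_of_nonneg_right (hwW i) (mul_nonneg (hw i) (hV0 i))
    have hc : 0 ≤ q + 1 - g := by linarith
    have h11 : (q + 1 - g) * (w i ^ 2 * e i) ≤ (1 + q) * (W * (w i * e i)) :=
      mul_le_mul (by linarith) h9 (mul_nonneg (sq_nonneg _) (he i)) (by linarith)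
    have h1 := mul_le_mul_of_nonneg_left
      (client_moment_le hq hg hg1 hκg (hV0 i) (hG i) (hN i)) (sq_nonneg (w i))
    have h2 := mul_le_mul_of_nonneg_left h11 (by positivity : 0 ≤ κ * (8 * L))
    have h3 := mul_le_mul_of_nonneg_left h10 (by positivity : 0 ≤ κ * (11 * (1 + q) * L ^ 2))
    linarith
  have h1 := Finset.sum_le_sum fun i (_ : i ∈ Finset.univ) => hTi i
  simpa only [Finset.sum_add_distrib, ← Finset.mul_sum, ← hΦ] using h1

/-- The weighted sum of the drifts, when the drift enters its own bound with a factor of at most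
`4 / 256`. -/
lemma sum_drift_le {ι : Type*} [Fintype ι] {w e Z G V : ι → ℝ} {L q s h Φ : ℝ}
    (hw : ∀ i, 0 ≤ w i) (hw1 : ∑ i, w i = 1) (hq : 0 ≤ q)
    (hhL : h ^ 2 * ((1 + q) * L ^ 2) ≤ 1 / 256)
    (hV0 : ∀ i, 0 ≤ V i) (hΦ : Φ = ∑ i, w i * e i)
    (hG : ∀ i, G i ≤ 6 * L * e i + 3 * L * Z i)
    (hV : ∀ i, V i ≤ 2 * h ^ 2 * ((1 + q) * (2 * G i + 2 * (L ^ 2 * V i)) + s)) :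
    ∑ i, w i * V i ≤
      64 / 63 * (2 * h ^ 2 * ((1 + q) * (2 * (6 * L * Φ + 3 * L * ∑ i, w i * Z i)) + s)) := by
  have hVi : ∀ i, V i ≤
      64 / 63 * (2 * h ^ 2 * ((1 + q) * (2 * (6 * L * e i + 3 * L * Z i)) + s)) := by
    intro i
    have h1 : 2 * h ^ 2 * ((1 + q) * (2 * G i)) ≤
        2 * h ^ 2 * ((1 + q) * (2 * (6 * L * e i + 3 * L * Z i))) := by
      have := hG i
      gcongr
    have h2 := mul_le_mul_of_nonneg_right hhL (hV0 i)
    have h3 := hV i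
    linarith
  have h1 : ∑ i, w i * V i ≤ ∑ i, w i *
      (64 / 63 * (2 * h ^ 2 * ((1 + q) * (2 * (6 * L * e i + 3 * L * Z i)) + s))) :=
    Finset.sum_le_sum fun i _ => mul_le_mul_of_nonneg_left (hVi i) (hw i)
  refine h1.trans_eq ?_
  have h2 : ∀ i, w i *
      (64 / 63 * (2 * h ^ 2 * ((1 + q) * (2 * (6 * L * e i + 3 * L * Z i)) + s))) =
      (64 / 63 * (2 * h ^ 2 * ((1 + q) * (2 * (6 * L))))) * (w i * e i) +
      (64 / 63 * (2 * h ^ 2 * ((1 + q) * (2 * (3 * L))))) * (w i * Z i) +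
      (64 / 63 * (2 * h ^ 2 * s)) * w i := fun i => by ring
  simp only [h2, Finset.sum_add_distrib, ← Finset.mul_sum, hw1, ← hΦ]
  ring

/-- The step size conditions make the drift and the second moment cost at most `13 / 8` of the
suboptimality `Φ`, up to the noise and the mismatch of the clients. -/
lemma recursion_arithmetic {W L q s a h g κ Φ G₀ Q S2 Z1 Z2 T : ℝ}
    (hL : 0 < L) (hq : 0 ≤ q) (hs : 0 ≤ s) (ha : 0 < a)
    (hκ : 1 ≤ κ) (hh2 : h ^ 2 ≤ a ^ 2 * (S2 * κ))
    (haL : a * L ≤ 1 / 16) (hhL : h ^ 2 * ((1 + q) * L ^ 2) ≤ a ^ 2 * ((1 + q) * L ^ 2))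
    (hhL' : h ^ 2 * ((1 + q) * L ^ 2) ≤ 1 / 256)
    (hstep : a * L * (1 + κ * ((1 + q) * W)) ≤ 1 / 8)
    (hΦ0 : 0 ≤ Φ) (hQ0 : 0 ≤ Q) (hZ10 : 0 ≤ Z1) (hS20 : 0 ≤ S2) (hG₀ : G₀ ≤ 2 * L * Φ)
    (hQ : Q ≤ 64 / 63 * (2 * h ^ 2 * ((1 + q) * (2 * (6 * L * Φ + 3 * L * Z1)) + s)))
    (hT : T ≤ κ * (8 * L * (1 + q) * W) * Φ + κ * (4 * L * (q + 1 - g)) * Z2 +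
      κ * (11 * (1 + q) * L ^ 2 * W) * Q + κ * (8 / 7 * s) * S2) :
    2 * L * Q + a * (4 / 3 * G₀ + 11 * (L ^ 2 * Q) + T) ≤
    13 / 8 * Φ + a * (κ * (2 * s) * S2 + κ * (4 * L * (q + 1 - g)) * Z2) +
      a ^ 2 * (72 * L ^ 2 * (1 + q) * Z1) := by
  have hκ0 : 0 ≤ κ := by linarith
  have hLΦ := mul_nonneg hL.le hΦ0
  -- The second step size condition absorbs the suboptimality and the drift in the second moment.
  have hA : a * (4 / 3 * G₀ + 11 * (L ^ 2 * Q) + T) ≤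
      Φ + 11 / 8 * (L * Q) + a * (κ * (4 * L * (q + 1 - g)) * Z2 + κ * (8 / 7 * s) * S2) := by
    have h1 : 4 / 3 * G₀ ≤ 8 * (L * Φ) := by linarith
    have h2 := mul_le_mul_of_nonneg_right hstep hΦ0
    have h3 := mul_le_mul_of_nonneg_right hstep (mul_nonneg hL.le hQ0)
    have h4 := mul_le_mul_of_nonneg_left (add_le_add h1 hT) ha.le
    linarith
  -- The first step size condition makes the drift itself small.
  have hB : 27 / 8 * (L * Q) ≤ 5 / 8 * Φ + a ^ 2 * (72 * L ^ 2 * (1 + q) * Z1) +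
      6 / 7 * (a * (κ * s * S2)) := by
    have h1 := mul_le_mul_of_nonneg_left hQ hL.le
    have h2 := mul_le_mul_of_nonneg_right hhL' hΦ0
    have h3 := mul_le_mul_of_nonneg_right hhL hZ10
    have h4 : 0 ≤ a ^ 2 * (L ^ 2 * (1 + q) * Z1) := by positivity
    have h7 : 0 ≤ a * (κ * s * S2) := by positivity
    have h5 : L * (h ^ 2 * s) ≤ 1 / 16 * (a * (κ * s * S2)) := by
      calc L * (h ^ 2 * s) ≤ L * (a ^ 2 * (S2 * κ) * s) := by gcongr
        _ = a * L * (a * (κ * s * S2)) := by ring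
        _ ≤ _ := mul_le_mul_of_nonneg_right haL h7
    linarith
  linarith

/-- The arithmetic of one round. Here `q = M / R`, `s = σ² / R`, `a` is the effective step size,
`h` the total local step size, `g` the relative improvement factor and `Φ` the expected
suboptimality; for each client, `e` is the expected Bregman divergence, `G` the second moment of the
gradient at the start of the round, `V` the drift, `N` the second moment of the averaged noise. -/
lemma round_arithmetic {ι : Type*} [Fintype ι] {w e Z G V N : ι → ℝ}
    {W L q s a h g Φ G₀ : ℝ} (hw : ∀ i, 0 ≤ w i) (hw1 : ∑ i, w i = 1) (hwW : ∀ i, w i ≤ W)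
    (hL : 0 < L) (hq : 0 ≤ q) (hs : 0 ≤ s) (ha : 0 < a) (hh : 0 ≤ h) (hha : h ≤ a)
    (hg : 0 < g) (hg1 : g ≤ 1) (hh2 : h ^ 2 ≤ a ^ 2 * ((∑ i, w i ^ 2) / g))
    (ha1 : a * (L * (2 + q)) ≤ 1 / 8) (ha2 : a * ((1 + W * (1 + q)) * L) / g ≤ 1 / 8)
    (he : ∀ i, 0 ≤ e i) (hZ : ∀ i, 0 ≤ Z i) (hV0 : ∀ i, 0 ≤ V i)
    (hΦ : Φ = ∑ i, w i * e i) (hG₀ : G₀ ≤ 2 * L * Φ)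
    (hG : ∀ i, G i ≤ 6 * L * e i + 3 * L * Z i)
    (hV : ∀ i, V i ≤ 2 * h ^ 2 * ((1 + q) * (2 * G i + 2 * (L ^ 2 * V i)) + s))
    (hN : ∀ i, N i ≤ q * (7 / 6 * G i + 7 * (L ^ 2 * V i)) + s) :
    2 * L * ∑ i, w i * V i + a * (4 / 3 * G₀ + 11 * (L ^ 2 * ∑ i, w i * V i) +
      (8 / 7 * ∑ i, w i ^ 2 * N i + (1 / g - 1) * ∑ i, w i ^ 2 *
        (4 / 3 * G i + 11 * (L ^ 2 * V i) + 8 / 7 * N i))) ≤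
    13 / 8 * Φ + a * (2 * s / g * ∑ i, w i ^ 2 +
      4 * L / g * (q + 1 - g) * ∑ i, w i ^ 2 * Z i) +
      a ^ 2 * (72 * L ^ 2 * (1 + q) * ∑ i, w i * Z i) := by
  have hκ : 1 ≤ 1 / g := (one_le_div hg).2 hg1
  have hκg : 1 / g * g = 1 := by field_simp
  -- `(1 + q) (a L)² ≤ ((2 + q) a L / 2)²`
  have haL : a ^ 2 * ((1 + q) * L ^ 2) ≤ 1 / 256 := by
    have h1 : a ^ 2 * ((1 + q) * L ^ 2) ≤ (a * (L * (2 + q))) ^ 2 / 4 := by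
      nlinarith [sq_nonneg (a * L * q)]
    have h2 : (a * (L * (2 + q))) ^ 2 ≤ (1 / 8) ^ 2 :=
      pow_le_pow_left₀ (by positivity) ha1 2
    linarith
  have haL' : a * L ≤ 1 / 16 := by
    have : 0 ≤ a * (L * q) := by positivity
    linarith
  have hhL : h ^ 2 * ((1 + q) * L ^ 2) ≤ a ^ 2 * ((1 + q) * L ^ 2) := by gcongr
  have hstep : a * L * (1 + 1 / g * ((1 + q) * W)) ≤ 1 / 8 := by
    have h1 : a * ((1 + W * (1 + q)) * L) / g = a * L * (1 / g + 1 / g * ((1 + q) * W)) := by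
      field_simp
    rw [h1] at ha2
    refine le_trans ?_ ha2
    gcongr
  have hh2' : h ^ 2 ≤ a ^ 2 * ((∑ i, w i ^ 2) * (1 / g)) := by
    rwa [mul_one_div]
  have hΦ0 : 0 ≤ Φ := hΦ ▸ Finset.sum_nonneg fun i _ => mul_nonneg (hw i) (he i)
  refine (recursion_arithmetic hL hq hs ha hκ hh2' haL' hhL (hhL.trans haL) hstep hΦ0
    (Finset.sum_nonneg fun i _ => mul_nonneg (hw i) (hV0 i))
    (Finset.sum_nonneg fun i _ => mul_nonneg (hw i) (hZ i))
    (Finset.sum_nonneg fun i _ => sq_nonneg _) hG₀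
    (sum_drift_le hw hw1 hq (hhL.trans haL) hV0 hΦ hG hV)
    (sum_client_moment_le hw hwW hL hq hg hg1 (zero_le_one.trans hκ) hκg he hV0 hΦ hG
      hN)).trans_eq ?_
  ring

namespace FedAvg.Standing

variable {n d : ℕ} {A : FedAvg n d} {Ω : Type*} [mΩ : MeasurableSpace Ω] {P : Measure Ω}
  [IsProbabilityMeasure P]
  {ξ : ℕ → Fin n → ℕ → Ω → Vec d} {S : ℕ → Ω → Finset (Fin n)} {K k : ℕ}
  {L μ M σ : ℝ} {xstar : Vec d} (H : A.Standing P ξ S K L μ M σ xstar)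
include H

/-- The exact one-round recursion in terms of the averaged stochastic gradients. -/
lemma integral_norm_x_succ_sub_sq_eq (hk : k < K) :
    ∫ ω, ‖A.x ξ S (k + 1) ω - xstar‖ ^ 2 ∂P =
      ∫ ω, ‖A.x ξ S k ω - xstar‖ ^ 2 ∂P -
      2 * A.η k * ∫ ω, inner ℝ (A.x ξ S k ω - xstar)
        (∑ i, A.w i • (A.avgGrad ξ S k i ω + A.avgNoise ξ k i ω)) ∂P +
      A.η k ^ 2 * (∫ ω, ‖∑ i, A.w i • (A.avgGrad ξ S k i ω + A.avgNoise ξ k i ω)‖ ^ 2 ∂P +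
        (1 / A.γ ξ S P k - 1) *
          ∑ i, A.w i ^ 2 * ∫ ω, ‖A.avgGrad ξ S k i ω + A.avgNoise ξ k i ω‖ ^ 2 ∂P) := by
  have hr : MemLp (fun ω => A.x ξ S k ω - xstar) 2 P := (H.memLp_x hk.le).sub (memLp_const _)
  have hv : MemLp (fun ω => ∑ i, A.w i • (A.avgGrad ξ S k i ω + A.avgNoise ξ k i ω)) 2 P :=
    memLp_finsetSum _ fun i _ =>
      ((H.memLp_avgGrad hk i).add (H.memLp_avgNoise hk i)).const_smul (A.w i)
  have hηU : ∀ ω, A.ηg k • ∑ i, A.w i • A.U ξ S k i ω =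
      A.η k • ∑ i, A.w i • (A.avgGrad ξ S k i ω + A.avgNoise ξ k i ω) := by
    intro ω
    have h1 : ∀ i, A.w i • A.U ξ S k i ω =
        (A.R * A.ηl k) • A.w i • (A.avgGrad ξ S k i ω + A.avgNoise ξ k i ω) := fun i => by
      rw [A.U_eq_avg H.R_pos.ne', smul_comm]
    rw [Finset.sum_congr rfl fun i _ => h1 i, ← Finset.smul_sum, smul_smul, η,
      mul_comm (A.ηg k)]
  have hU : ∀ i, ∫ ω, ‖A.U ξ S k i ω‖ ^ 2 ∂P =
      (A.R * A.ηl k) ^ 2 * ∫ ω, ‖A.avgGrad ξ S k i ω + A.avgNoise ξ k i ω‖ ^ 2 ∂P := by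
    intro i
    simp only [A.U_eq_avg H.R_pos.ne', norm_smul, mul_pow _ ‖_‖, Real.norm_eq_abs, sq_abs]
    rw [integral_const_mul]
  rw [(H.integral_norm_x_succ_sub_sq hk (H.memLp_x hk.le) xstar).2,
    H.integral_samplingVariance_p hk]
  have e : ∀ ω, ‖A.x ξ S k ω - xstar - A.η k •
      ∑ i, A.w i • (A.avgGrad ξ S k i ω + A.avgNoise ξ k i ω)‖ ^ 2 =
      ‖A.x ξ S k ω - xstar‖ ^ 2 - 2 * A.η k * inner ℝ (A.x ξ S k ω - xstar)
        (∑ i, A.w i • (A.avgGrad ξ S k i ω + A.avgNoise ξ k i ω)) +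
      A.η k ^ 2 * ‖∑ i, A.w i • (A.avgGrad ξ S k i ω + A.avgNoise ξ k i ω)‖ ^ 2 := by
    intro ω
    rw [norm_sub_sq_real, inner_smul_right, norm_smul, mul_pow, Real.norm_eq_abs, sq_abs]
    ring
  have i1 := hr.integrable_norm_sq
  have i2 := (hr.integrable_inner_of_two hv).const_mul (2 * A.η k)
  have i3 := hv.integrable_norm_sq.const_mul (A.η k ^ 2)
  have i12 : Integrable (fun ω => ‖A.x ξ S k ω - xstar‖ ^ 2 - 2 * A.η k *
      inner ℝ (A.x ξ S k ω - xstar)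
        (∑ i, A.w i • (A.avgGrad ξ S k i ω + A.avgNoise ξ k i ω))) P := i1.sub i2
  simp only [hηU, hU, e]
  rw [integral_add i12 i3, integral_sub i1 i2]
  simp only [integral_const_mul, mul_left_comm _ ((A.R * A.ηl k) ^ 2), ← Finset.mul_sum, η]
  ring

end FedAvg.Standing

namespace FedAvg.Standing

variable {n d : ℕ} {A : FedAvg n d} {Ω : Type*} [mΩ : MeasurableSpace Ω] {P : Measure Ω}
  {ξ : ℕ → Fin n → ℕ → Ω → Vec d} {S : ℕ → Ω → Finset (Fin n)} {K k : ℕ}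
  {L μ M σ : ℝ} {xstar : Vec d} (H : A.Standing P ξ S K L μ M σ xstar)
include H

lemma Z_nonneg (i : Fin n) : 0 ≤ A.Z xstar i :=
  sub_nonneg.2 (ciInf_le ((H.convex i).bddBelow H.μ_pos) xstar)

lemma sum_w_sq_pos : 0 < ∑ i, A.w i ^ 2 := by
  refine (Finset.sum_nonneg fun i _ => sq_nonneg _).lt_of_ne fun h0 => ?_
  have h1 := (Finset.sum_eq_zero_iff_of_nonneg fun i _ => sq_nonneg (A.w i)).1 h0.symm
  have h2 : ∑ i, A.w i = 0 := Finset.sum_eq_zero fun i hi =>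
    (pow_eq_zero_iff two_ne_zero).1 (h1 i hi)
  linarith [H.w_sum]

lemma W_nonneg : 0 ≤ A.W := Real.iSup_nonneg H.w_nonneg

omit H in
lemma w_le_W (A : FedAvg n d) (i : Fin n) : A.w i ≤ A.W :=
  le_ciSup (Set.finite_range A.w).bddAbove i

/-- The drift and the second moment of a round under the step size conditions. -/
lemma drift_add_moment_le [IsProbabilityMeasure P] (hk : k < K)
    (hηg1 : 1 ≤ A.ηg k) (hηg : √(A.γ ξ S P k / ∑ i, A.w i ^ 2) ≤ A.ηg k) (hη0 : 0 < A.η k)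
    (hη : A.η k ≤ 1 / 8 * min (1 / (L * (2 + M / A.R)))
      (A.γ ξ S P k / ((1 + A.W * (1 + M / A.R)) * L))) :
    2 * L * ∑ i, A.w i * ∫ ω, A.drift ξ S k i ω ∂P +
      A.η k * (∫ ω, ‖∑ i, A.w i • (A.avgGrad ξ S k i ω + A.avgNoise ξ k i ω)‖ ^ 2 ∂P +
        (1 / A.γ ξ S P k - 1) *
          ∑ i, A.w i ^ 2 * ∫ ω, ‖A.avgGrad ξ S k i ω + A.avgNoise ξ k i ω‖ ^ 2 ∂P) ≤
    13 / 8 * ∫ ω, (A.obj (A.x ξ S k ω) - A.obj xstar) ∂P +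
      A.η k * A.β₁ xstar L M σ (A.γ ξ S P k) + A.η k ^ 2 * A.β₂ xstar L M := by
  have hR := H.R_pos
  have hL := H.L_pos
  have hγ := H.γ_pos k
  have hγ1 := H.γ_le_one k
  have hS2 := H.sum_w_sq_pos
  have hq : 0 ≤ M / A.R := div_nonneg H.M_nonneg hR.le
  have hηh : A.η k = A.R * A.ηl k * A.ηg k := rfl
  have hh : 0 < A.R * A.ηl k := pos_of_mul_pos_left (hηh ▸ hη0) (zero_le_one.trans hηg1)
  have hh2 : (A.R * A.ηl k) ^ 2 ≤ A.η k ^ 2 * ((∑ i, A.w i ^ 2) / A.γ ξ S P k) := by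
    have h1 := (Real.sqrt_le_iff.1 hηg).2
    rw [div_le_iff₀ hS2] at h1
    rw [hηh, mul_pow _ (A.ηg k), mul_assoc, ← mul_div_assoc]
    exact le_mul_of_one_le_right (sq_nonneg _) ((one_le_div hγ).2 h1)
  have hη1 : A.η k * (L * (2 + M / A.R)) ≤ 1 / 8 := by
    have h1 := hη.trans (mul_le_mul_of_nonneg_left (min_le_left _ _) (by norm_num))
    rwa [mul_one_div, le_div_iff₀ (by positivity)] at h1
  have hη2 : A.η k * ((1 + A.W * (1 + M / A.R)) * L) / A.γ ξ S P k ≤ 1 / 8 := by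
    have hW := H.W_nonneg
    have h1 := hη.trans (mul_le_mul_of_nonneg_left (min_le_right _ _) (by norm_num))
    rw [← mul_div_assoc, le_div_iff₀ (by positivity)] at h1
    rwa [div_le_iff₀ hγ]
  have hG₀ : ∫ ω, ‖∑ i, A.w i • gradient (A.f i) (A.x ξ S k ω)‖ ^ 2 ∂P ≤
      2 * L * ∫ ω, (A.obj (A.x ξ S k ω) - A.obj xstar) ∂P := by
    have hg : MemLp (fun ω => ∑ i, A.w i • gradient (A.f i) (A.x ξ S k ω)) 2 P :=
      memLp_finsetSum _ fun i _ => (H.memLp_gradient_x hk i).const_smul (A.w i)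
    rw [← integral_const_mul]
    exact integral_mono hg.integrable_norm_sq ((H.integrable_obj_sub hk).const_mul _) fun ω =>
      A.norm_sum_gradient_sq_le hL H.μ_pos H.w_nonneg H.w_sum H.smooth H.convex H.minimizer _
  have hG : ∀ i, ∫ ω, ‖gradient (A.f i) (A.x ξ S k ω)‖ ^ 2 ∂P ≤
      6 * L * ∫ ω, bregman (A.f i) (A.x ξ S k ω) xstar ∂P + 3 * L * A.Z xstar i := by
    intro i
    have ib := (H.integrable_bregman hk i xstar).const_mul (6 * L)
    have e : 6 * L * ∫ ω, bregman (A.f i) (A.x ξ S k ω) xstar ∂P + 3 * L * A.Z xstar i =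
        ∫ ω, (6 * L * bregman (A.f i) (A.x ξ S k ω) xstar + 3 * L * A.Z xstar i) ∂P := by
      rw [integral_add ib (integrable_const _), integral_const_mul]
      simp
    rw [e]
    exact integral_mono (H.memLp_gradient_x hk i).integrable_norm_sq
      (ib.add (integrable_const _)) fun ω =>
        (H.smooth i).norm_gradient_sq_le_bregman hL (H.convex i) H.μ_pos _ _
  have hV : ∀ i, ∫ ω, A.drift ξ S k i ω ∂P ≤ 2 * (A.R * A.ηl k) ^ 2 *
      ((1 + M / A.R) * (2 * ∫ ω, ‖gradient (A.f i) (A.x ξ S k ω)‖ ^ 2 ∂P +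
        2 * (L ^ 2 * ∫ ω, A.drift ξ S k i ω ∂P)) + σ ^ 2 / A.R) := by
    intro i
    have h1 := H.gradMoment_le hk i zero_lt_one
    norm_num at h1
    refine (H.integral_drift_le hk i).trans ?_
    gcongr
  have hN : ∀ i, ∫ ω, ‖A.avgNoise ξ k i ω‖ ^ 2 ∂P ≤ M / A.R *
      (7 / 6 * ∫ ω, ‖gradient (A.f i) (A.x ξ S k ω)‖ ^ 2 ∂P +
        7 * (L ^ 2 * ∫ ω, A.drift ξ S k i ω ∂P)) + σ ^ 2 / A.R := by
    intro i
    have h1 := H.gradMoment_le hk i (c := 1 / 6) (by norm_num)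
    norm_num at h1
    refine (H.integral_norm_avgNoise_sq_le hk i).trans ?_
    gcongr
  have key := round_arithmetic H.w_nonneg H.w_sum (w_le_W A) hL hq
    (by positivity : 0 ≤ σ ^ 2 / A.R) hη0 hh.le
    (hηh ▸ le_mul_of_one_le_right hh.le hηg1) hγ hγ1 hh2 hη1 hη2
    (fun i => integral_nonneg fun ω => (H.convex i).bregman_nonneg H.μ_pos _ _) H.Z_nonneg
    (fun i => integral_nonneg fun ω => A.drift_nonneg ω) (H.integral_obj_sub hk) hG₀ hG hV hN
  have hκ : 0 ≤ 1 / A.γ ξ S P k - 1 := sub_nonneg.2 ((one_le_div hγ).2 hγ1)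
  have h1 := mul_le_mul_of_nonneg_left (Finset.sum_le_sum fun i (_ : i ∈ Finset.univ) =>
    mul_le_mul_of_nonneg_left (H.integral_norm_update_sq_le hk i) (sq_nonneg (A.w i))) hκ
  have h2 := mul_le_mul_of_nonneg_left
    (add_le_add (H.integral_norm_sum_update_sq_le hk) h1) hη0.le
  have hβ₁ : A.β₁ xstar L M σ (A.γ ξ S P k) =
      2 * (σ ^ 2 / A.R) / A.γ ξ S P k * ∑ i, A.w i ^ 2 + 4 * L / A.γ ξ S P k *
        (M / A.R + 1 - A.γ ξ S P k) * ∑ i, A.w i ^ 2 * A.Z xstar i := by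
    rw [β₁]
    congr 2
    field_simp
  have hβ₂ : A.β₂ xstar L M = 72 * L ^ 2 * (1 + M / A.R) * ∑ i, A.w i * A.Z xstar i := rfl
  rw [hβ₁, hβ₂]
  refine le_trans ?_ key
  linarith

end FedAvg.Standing

end

theorem mainTheorem5 {n d : ℕ} (A : FedAvg n d)
    {Ω : Type*} [MeasurableSpace Ω] (P : Measure Ω) [IsProbabilityMeasure P]
    (ξ : ℕ → Fin n → ℕ → Ω → Vec d) (S : ℕ → Ω → Finset (Fin n))
    (K : ℕ) (L μ M σ : ℝ) (xstar : Vec d)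
    (hm : 1 ≤ A.m) (hmn : A.m ≤ n) (hR : 2 ≤ A.R)
    (hw : ∀ i, 0 ≤ A.w i) (hw1 : ∑ i, A.w i = 1)
    (hL : 0 < L) (hμ : 0 < μ) (hM : 0 ≤ M)
    (hsmooth : ∀ i, LSmooth L (A.f i))
    (hconv : ∀ i, GradStronglyConvex μ (A.f i))
    (hstar : ∀ z, A.obj xstar ≤ A.obj z)
    (horacle : A.GradientOracle ξ S P K M σ)
    (hsampling : A.OptimalClientSampling ξ S P K)
    (k : ℕ) (hk : k < K)
    (hηg1 : 1 ≤ A.ηg k)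
    (hηg : √(A.γ ξ S P k / ∑ i, A.w i ^ 2) ≤ A.ηg k)
    (hη0 : 0 < A.η k)
    (hη : A.η k ≤ 1 / 8 * min (1 / (L * (2 + M / A.R)))
      (A.γ ξ S P k / ((1 + A.W * (1 + M / A.R)) * L))) :
    Integrable (fun ω => A.obj (A.x ξ S k ω) - A.obj xstar) P ∧
    Integrable (fun ω => ‖A.x ξ S k ω - xstar‖ ^ 2) P ∧
    Integrable (fun ω => ‖A.x ξ S (k + 1) ω - xstar‖ ^ 2) P ∧
    3 / 8 * ∫ ω, (A.obj (A.x ξ S k ω) - A.obj xstar) ∂P ≤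
      1 / A.η k * (1 - μ * A.η k / 2) * ∫ ω, ‖A.x ξ S k ω - xstar‖ ^ 2 ∂P
      - 1 / A.η k * ∫ ω, ‖A.x ξ S (k + 1) ω - xstar‖ ^ 2 ∂P
      + A.η k * A.β₁ xstar L M σ (A.γ ξ S P k)
      + A.η k ^ 2 * A.β₂ xstar L M := by
  have H : A.Standing P ξ S K L μ M σ xstar :=
    ⟨hm, hmn, hR, hw, hw1, hL, hμ, hM, hsmooth, hconv, hstar, horacle, hsampling⟩
  refine ⟨H.integrable_obj_sub hk, ((H.memLp_x hk.le).sub (memLp_const _)).integrable_norm_sq,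
    (H.integral_norm_x_succ_sub_sq hk (H.memLp_x hk.le) xstar).1, ?_⟩
  have h1 := H.drift_add_moment_le hk hηg1 hηg hη0 hη
  have h2 := H.le_integral_inner_update hk
  rw [H.integral_norm_x_succ_sub_sq_eq hk]
  set r := ∫ ω, ‖A.x ξ S k ω - xstar‖ ^ 2 ∂P
  set I := ∫ ω, inner ℝ (A.x ξ S k ω - xstar)
    (∑ i, A.w i • (A.avgGrad ξ S k i ω + A.avgNoise ξ k i ω)) ∂P
  set T := ∫ ω, ‖∑ i, A.w i • (A.avgGrad ξ S k i ω + A.avgNoise ξ k i ω)‖ ^ 2 ∂P +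
    (1 / A.γ ξ S P k - 1) *
      ∑ i, A.w i ^ 2 * ∫ ω, ‖A.avgGrad ξ S k i ω + A.avgNoise ξ k i ω‖ ^ 2 ∂P
  have e : 1 / A.η k * (1 - μ * A.η k / 2) * r -
      1 / A.η k * (r - 2 * A.η k * I + A.η k ^ 2 * T) = 2 * I - μ / 2 * r - A.η k * T := by
    field_simp
    ring
  rw [e]
  linarith
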